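/- Fix $n\ge 0$. For an ordered decomposition $\{1,\dots,n\}=I_1\sqcup\dots\sqcup I_p$ into nonempty blocks let $[I_1,\dots,I_p]$ be the $(n-p)$-dimensional face of the permutohedron $P_n=\operatorname{Conv}(\mathfrak S_n\cdot(1,\dots,n))\subset\mathbb R^n$ whose vertices are the points $(\sigma(1),\dots,\sigma(n))$, $\sigma\in\mathfrak S_n$, with $\sigma(i)<\sigma(j)$ whenever $i\in I_\mu$, $j\in I_\nu$, $\mu<\nu$. Its subfaces are given by the ordered decompositions that refine $(I_1,\dots,I_p)$. Choose an orientation of every face, and for a codimension one inclusion of faces $F\subset F'$ let $\varepsilon_{FF'}=\pm1$ be the resulting incidence sign. Let $C^m(P_n)$ be the complex vector space with basis $\mathbf 1_F$, $F$ running over the $m$-dimensional faces of $P_n$. Let $\mathfrak L=\|\lambda_{ij}\|_{i\ne j}$ be an $n\times n$ matrix of complex numbers (diagonal entries play no role). If $F$ is obtained from $F'$ by replacing one block $I_\nu$ by two consecutive nonempty blocks $(I',I'')$ with $I_\nu=I'\sqcup I''$, put $\lambda_{FF'}=\prod_{i'\in I',\,i''\in I''}\lambda_{i'i''}$, and define $$d_{\mathfrak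 L}:C^m(P_n)\to C^{m+1}(P_n),\qquad d_{\mathfrak L}(\mathbf 1_F)=\sum_{F'\supset F}\lambda_{FF'}\,\varepsilon_{FF'}\,\mathbf 1_{F'},$$ where $F'$ runs over the $(m+1)$-dimensional faces containing $F$. A wheel for $\mathfrak L$ is a sequence $i_1,\dots,i_m$ of $m\ge2$ distinct indices with $\lambda_{i_1i_2}=\lambda_{i_2i_3}=\dots=\lambda_{i_{m-1}i_m}=\lambda_{i_mi_1}=0$. **Proposition.** (1) If $\mathfrak L$ has no wheels, then the complex $(C^\bullet(P_n),d_{\mathfrak L})$ is exact outside of the leftmost term $C^0(P_n)$, where the cohomology $\ker(d_{\mathfrak L}:C^0(P_n)\to C^1(P_n))$ is $1$-dimensional. (2) Let $Z\subset\{(i,j):1\le i<j\le n\}$ be any set of positive roots of $A_{n-1}$. For a face $F=[I_1,\dots,I_p]$ let $\operatorname{dpt}(F)$ be the number of pairs $(i,j)\in Z$ such that $i\in I_\mu$, $j\in I_\nu$ for some $\mu<\nu$. Then for every integer $r\ge0$ the polyhedral complex $P^{(r)}=\bigcup_{\operatorname{dpt}(F)\ge r}F\subset P_n$ is empty or contractible.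 -/

import Mathlib

/-- The vertex `(σ(1), …, σ(n))` of the permutohedron; indices and values are shifted by one
because `Fin n` starts at `0`. -/
def permVertex {n : ℕ} (σ : Equiv.Perm (Fin n)) : Fin n → ℝ := fun i => ((σ i : ℕ) : ℝ) + 1

/-- The permutohedron `P_n = Conv(𝔖_n · (1, 2, …, n)) ⊂ ℝⁿ`. -/
def permutohedron (n : ℕ) : Set (Fin n → ℝ) := convexHull ℝ (Set.range (permVertex (n := n)))

/-- An `m`-dimensional face `[I_1, …, I_p]` of `P_n`, `p + m = n`, given by the ordered
decomposition of the index set into nonempty blocks. The decomposition is encoded by the surjection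
`label` that sends an index to the position of its block, so `I_ν = label ⁻¹' {ν}`. -/
@[ext]
structure PermFace (n m : ℕ) where
  /-- the number `p` of blocks -/
  numBlocks : ℕ
  /-- the position of the block that contains a given index -/
  label : Fin n → Fin numBlocks
  surj : Function.Surjective label
  dim_eq : numBlocks + m = n

namespace PermFace

variable {n m k : ℕ}

instance : Finite (PermFace n m) := by
  refine Finite.of_injective
    (β := (p : Fin (n + 1)) × (Fin n → Fin (p : ℕ)))
    (fun F => ⟨⟨F.numBlocks, by have := F.dim_eq; omega⟩, F.label⟩) ?_
  rintro ⟨p, f, hf, hp⟩ ⟨q, g, hg, hq⟩ h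
  obtain rfl : p = q := by omega
  simpa using h

noncomputable instance : Fintype (PermFace n m) := Fintype.ofFinite _

/-- The vertices of `[I_1, …, I_p]`: those `(σ(1), …, σ(n))` for which the values of `σ` on an
earlier block are smaller than its values on a later block. -/
def vertices (F : PermFace n m) : Set (Fin n → ℝ) :=
  permVertex '' {σ | ∀ i j, F.label i < F.label j → σ i < σ j}

/-- The face as a subset of `ℝⁿ`. -/
def carrier (F : PermFace n m) : Set (Fin n → ℝ) := convexHull ℝ F.vertices

/-- The set `F.carrier` is a face of the permutohedron in the sense of convex geometry: it is the
set of the points of `P_n` at which the functional `x ↦ ∑ i, F.label i * x i` is maximal. -/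
theorem carrier_eq_maximizers (F : PermFace n m) :
    F.carrier = {x ∈ permutohedron n | ∀ y ∈ permutohedron n,
      ∑ i, ((F.label i : ℕ) : ℝ) * y i ≤ ∑ i, ((F.label i : ℕ) : ℝ) * x i} := by
  let l : (Fin n → ℝ) →ₗ[ℝ] ℝ := ∑ i, ((F.label i : ℕ) : ℝ) • LinearMap.proj i
  have hl : ∀ x, l x = ∑ i, ((F.label i : ℕ) : ℝ) * x i := fun x => by simp [l]
  let σ₀ : Equiv.Perm (Fin n) := (Tuple.sort F.label).symm
  have h₀ : ∀ i j, F.label i < F.label j → σ₀ i < σ₀ j := by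
    intro i j hij
    by_contra h
    have := Tuple.monotone_sort F.label (not_lt.mp h)
    simp only [σ₀, Function.comp, Equiv.apply_symm_apply] at this
    exact absurd hij (not_lt.mpr this)
  have hmono : Monovary (fun i => ((F.label i : ℕ) : ℝ)) (permVertex σ₀) := by
    intro i j hij
    by_contra h
    have hlt : F.label j < F.label i := by simpa using h
    have h1 := h₀ _ _ hlt
    simp only [permVertex, add_lt_add_iff_right, Nat.cast_lt] at hij
    omega
  have hcomp : ∀ σ : Equiv.Perm (Fin n),
      permVertex σ = permVertex σ₀ ∘ (σ.trans σ₀.symm : Equiv.Perm (Fin n)) := by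
    intro σ; funext i; simp [permVertex]
  have hle : ∀ σ, l (permVertex σ) ≤ l (permVertex σ₀) := by
    intro σ
    rw [hl, hl, hcomp σ]
    exact hmono.sum_mul_comp_perm_le_sum_mul
  have heq : ∀ σ, l (permVertex σ) = l (permVertex σ₀) ↔
      ∀ i j, F.label i < F.label j → σ i < σ j := by
    intro σ
    have h1 := hmono.sum_mul_comp_perm_eq_sum_mul_iff (σ := σ.trans σ₀.symm)
    rw [← hcomp σ] at h1
    rw [hl, hl]
    have h2 : ∑ i, ((F.label i : ℕ) : ℝ) * permVertex σ i =
        ∑ i, ((F.label i : ℕ) : ℝ) * permVertex σ₀ ((σ.trans σ₀.symm) i) := by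
      rw [hcomp σ]; rfl
    rw [h2, h1]
    constructor
    · intro h i j hij
      by_contra hji
      rcases eq_or_lt_of_le (not_lt.mp hji) with he | hlt
      · exact absurd (σ.injective he) (fun h => by simp [h] at hij)
      · have h3 : permVertex σ j < permVertex σ i := by simpa [permVertex] using hlt
        have h4 := h h3
        simp only [Nat.cast_le, Fin.val_fin_le] at h4
        exact absurd hij (not_lt.mpr h4)
    · intro h i j hij
      by_contra hji
      have hlt : F.label j < F.label i := by simpa using hji
      have h3 := h _ _ hlt
      simp only [permVertex, add_lt_add_iff_right, Nat.cast_lt] at hij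
      omega
  have hcar : ∀ x ∈ F.carrier, l x = l (permVertex σ₀) := by
    have : F.carrier ⊆ l ⁻¹' {l (permVertex σ₀)} := by
      refine convexHull_min ?_ ((convex_singleton _).linear_preimage l)
      rintro _ ⟨σ, hσ, rfl⟩
      exact (heq σ).2 hσ
    exact this
  have hK : permutohedron n ⊆
      {x | l x < l (permVertex σ₀)} ∪ F.carrier := by
    refine convexHull_min ?_ ?_
    · rintro _ ⟨σ, rfl⟩
      rcases (hle σ).lt_or_eq with h | h
      · exact Or.inl h
      · exact Or.inr (subset_convexHull ℝ _ ⟨σ, (heq σ).1 h, rfl⟩)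
    · intro x hx y hy a b ha hb hab
      have hx' : l x ≤ l (permVertex σ₀) := hx.elim (fun h => le_of_lt (by simpa using h)) fun h => (hcar x h).le
      have hy' : l y ≤ l (permVertex σ₀) := hy.elim (fun h => le_of_lt (by simpa using h)) fun h => (hcar y h).le
      rcases ha.eq_or_lt with rfl | ha'
      · obtain rfl : b = 1 := by linarith
        simpa using hy
      rcases hb.eq_or_lt with rfl | hb'
      · obtain rfl : a = 1 := by linarith
        simpa using hx
      have hab' : a * l (permVertex σ₀) + b * l (permVertex σ₀) = l (permVertex σ₀) := by
        rw [← add_mul, hab, one_mul]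
      rcases hx with hx | hx
      · left
        simp only [Set.mem_ofPred_eq, map_add, map_smul, smul_eq_mul] at hx ⊢
        have := mul_lt_mul_of_pos_left hx ha'
        have := mul_le_mul_of_nonneg_left hy' hb
        linarith
      rcases hy with hy | hy
      · left
        simp only [Set.mem_ofPred_eq, map_add, map_smul, smul_eq_mul] at hy ⊢
        have := mul_le_mul_of_nonneg_left hx' ha
        have := mul_lt_mul_of_pos_left hy hb'
        linarith
      · exact Or.inr (convex_convexHull ℝ _ hx hy ha hb hab)
  ext x
  simp only [Set.mem_ofPred_eq, ← hl]
  constructor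
  · intro hx
    refine ⟨convexHull_mono (Set.image_subset_range _ _) hx, fun y hy => ?_⟩
    rw [hcar x hx]
    exact (hK hy).elim (fun h => le_of_lt (by simpa using h)) fun h => (hcar y h).le
  · rintro ⟨hx, hmax⟩
    refine (hK hx).resolve_left fun h => absurd (hmax (permVertex σ₀) ?_) (not_le.mpr h)
    exact subset_convexHull ℝ _ ⟨σ₀, rfl⟩

/-- `F.Refines F'`: the sequence of blocks of `F` is obtained from that of `F'` by replacing each
block, in its turn, by a sequence of blocks; that is, `F` is a subface of `F'`. -/
def Refines (F : PermFace n m) (F' : PermFace n k) : Prop :=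
  ∀ i j, F.label i ≤ F.label j → F'.label i ≤ F'.label j

theorem Refines.carrier_subset {F : PermFace n m} {F' : PermFace n k} (h : F.Refines F') :
    F.carrier ⊆ F'.carrier := by
  refine convexHull_mono (Set.image_mono ?_)
  intro σ hσ i j hij
  exact hσ i j (lt_of_not_ge fun hji => absurd (h j i hji) (not_le.mpr hij))

/-- The linear space parallel to the affine span of the face. -/
abbrev direction (F : PermFace n m) : Submodule ℝ (Fin n → ℝ) := vectorSpan ℝ F.carrier

theorem Refines.direction_le {F : PermFace n m} {F' : PermFace n k} (h : F.Refines F') :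
    F.direction ≤ F'.direction :=
  vectorSpan_mono ℝ h.carrier_subset

end PermFace

/-- A choice of an orientation for each face of `P_n`. -/
abbrev FaceOrientation (n : ℕ) : Type :=
  ∀ (m : ℕ) (F : PermFace n m), Orientation ℝ F.direction (Fin m)

/-- The orientations of `F` and of the face `F'`, in which `F` has codimension one, are compatible:
an outward vector of `F'` along `F` (a difference `x - y` with `x` in `F` and `y` in `F'` but not in
`F`), followed by a positively oriented basis of `F`, is a positively oriented basis of `F'`.
This is expressed by contracting a volume form of `F'` with the outward vector. -/
def FaceOrientation.Compatible {n : ℕ} (o : FaceOrientation n) {m : ℕ}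
    (F : PermFace n m) (F' : PermFace n (m + 1)) (h : F.Refines F') : Prop :=
  ∃ (x : Fin n → ℝ) (hx : x ∈ F.carrier) (y : Fin n → ℝ) (hy : y ∈ F'.carrier),
    y ∉ F.carrier ∧
      SameRay ℝ
        (((o (m + 1) F').someVector.curryLeft
            ⟨x - y, vsub_mem_vectorSpan ℝ (h.carrier_subset hx) hy⟩).compLinearMap
          (Submodule.inclusion h.direction_le))
        (o m F).someVector

open Classical in
/-- The sign `ε_{FF'}`, extended by `0` to the pairs for which `F` is not a subface of `F'`. -/
noncomputable def FaceOrientation.sign {n : ℕ} (o : FaceOrientation n) {m : ℕ}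
    (F : PermFace n m) (F' : PermFace n (m + 1)) : ℂ :=
  if h : F.Refines F' then (if o.Compatible F F' h then 1 else -1) else 0

/-- `λ_{FF'}`: the product of the `λ_{ij}` over `i ∈ I'`, `j ∈ I''`, when `F` is obtained from `F'`
by replacing a block by `(I', I'')`. -/
noncomputable def faceWeight {n m : ℕ} (L : Matrix (Fin n) (Fin n) ℂ)
    (F : PermFace n m) (F' : PermFace n (m + 1)) : ℂ :=
  ∏ z : Fin n × Fin n with F'.label z.1 = F'.label z.2 ∧ F.label z.1 < F.label z.2, L z.1 z.2

/-- The cochains `C^m(P_n)` with complex coefficients: functions on the set of `m`-dimensional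
faces. The basis vector `𝟏_F` is `Pi.single F 1`. -/
abbrev permCochain (n m : ℕ) : Type := PermFace n m → ℂ

/-- The perturbed differential `d_L : C^m(P_n) → C^{m+1}(P_n)`,
`d_L(𝟏_F) = ∑_{F' ⊃ F} λ_{FF'} ε_{FF'} 𝟏_{F'}`. -/
noncomputable def perturbedDifferential {n : ℕ} (L : Matrix (Fin n) (Fin n) ℂ)
    (o : FaceOrientation n) (m : ℕ) : permCochain n m →ₗ[ℂ] permCochain n (m + 1) :=
  Matrix.mulVecLin (Matrix.of fun F' F => faceWeight L F F' * o.sign F F')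

open Classical in
theorem perturbedDifferential_single {n : ℕ} (L : Matrix (Fin n) (Fin n) ℂ)
    (o : FaceOrientation n) (m : ℕ) (F : PermFace n m) :
    perturbedDifferential L o m (Pi.single F 1) =
      ∑ F' with F.Refines F', (faceWeight L F F' * o.sign F F') • Pi.single F' (1 : ℂ) := by
  funext G
  simp only [perturbedDifferential, Matrix.mulVecLin_apply, Matrix.mulVec_single_one,
    Finset.sum_apply, Pi.smul_apply, Pi.single_apply, smul_eq_mul, mul_ite, mul_one, mul_zero,
    Finset.sum_ite_eq, Finset.mem_filter, Finset.mem_univ, true_and]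
  by_cases h : F.Refines G <;> simp [FaceOrientation.sign, h]

/-- A wheel for `L`: a sequence of `m ≥ 2` distinct indices `i_1, …, i_m` with
`λ_{i_1 i_2} = λ_{i_2 i_3} = ⋯ = λ_{i_m i_1} = 0`; `finRotate m` is the cyclic successor. The
diagonal entries of `L` play no role. -/
def IsWheel {n m : ℕ} (L : Matrix (Fin n) (Fin n) ℂ) (s : Fin m → Fin n) : Prop :=
  2 ≤ m ∧ Function.Injective s ∧ ∀ t, L (s t) (s (finRotate m t)) = 0

/-- The depth of a face with respect to `Z`: the number of pairs `(i, j)` in `Z` such that the block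
of `i` precedes the block of `j`. -/
def PermFace.depth {n m : ℕ} (F : PermFace n m) (Z : Finset (Fin n × Fin n)) : ℕ :=
  (Z.filter fun z => F.label z.1 < F.label z.2).card

/-- The polyhedral subcomplex `P^{(r)}` of `P_n`: the union of the faces of depth at least `r`. -/
def depthSubcomplex {n : ℕ} (Z : Finset (Fin n × Fin n)) (r : ℕ) : Set (Fin n → ℝ) :=
  ⋃ (m : ℕ) (F : PermFace n m) (_ : r ≤ F.depth Z), F.carrier

/-! A face is encoded by the chain `lows` of initial unions of its blocks; refinement is inclusion
of chains, and each step of codimension one adds a single set. Both halves of the theorem rest on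
one acyclic matching of the faces, depending on a permutation `ρ`. The pivot of a face is the
`ρ`-largest index that fails to come after all `ρ`-smaller ones; if it is a block by itself, it is
merged with the next block, and otherwise it is split off at the front of its block. This separates
or joins only `ρ`-decreasing pairs. The single unmatched face is the vertex ordered by `ρ`, and the
matching is acyclic because the number of `ρ`-increasing pairs in the right order grows strictly
along gradient paths (`Matched.ascents_lt`).

For (1), absence of wheels gives a `ρ` with `L i j ≠ 0` whenever `ρ j < ρ i`
(`exists_perm_of_no_wheel`). The matched coefficients of the differential are then nonzero, so its
block from lower to upper faces is square, triangular and invertible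
(`exists_differential_upper_eq`). With the relation `d² = 0`, this kills all cohomology except one
dimension coming from the unmatched vertex.

For (2), take `ρ = 1`. Matched faces have equal depth, so the depth subcomplex is a union of matched
pairs and the vertex. The pairs are removed one by one by elementary collapses, each realized by a
radial projection (`Refines.contractibleSpace_of_collapse`). -/

/-! ### Faces as chains of subsets -/

namespace PermFace

variable {n m k : ℕ}

/-- The initial unions of blocks of a face, including the empty one and the full one. -/
def lows (F : PermFace n m) : Finset (Finset (Fin n)) :=
  Finset.univ.filter fun A => ∀ i ∈ A, ∀ j, F.label j ≤ F.label i → j ∈ A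

theorem mem_lows {F : PermFace n m} {A : Finset (Fin n)} :
    A ∈ F.lows ↔ ∀ i ∈ A, ∀ j, F.label j ≤ F.label i → j ∈ A := by
  simp [lows]

theorem empty_mem_lows (F : PermFace n m) : ∅ ∈ F.lows := by simp [mem_lows]

theorem univ_mem_lows (F : PermFace n m) : Finset.univ ∈ F.lows := by simp [mem_lows]

theorem filter_le_mem_lows (F : PermFace n m) (i : Fin n) :
    (Finset.univ.filter fun j => F.label j ≤ F.label i) ∈ F.lows := by
  rw [mem_lows]
  intro a ha b hb
  simp only [Finset.mem_filter, Finset.mem_univ, true_and] at ha ⊢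
  exact hb.trans ha

theorem label_le_iff (F : PermFace n m) {i j : Fin n} :
    F.label i ≤ F.label j ↔ ∀ A ∈ F.lows, j ∈ A → i ∈ A := by
  constructor
  · intro h A hA hj
    exact mem_lows.1 hA j hj i h
  · intro h
    simpa using h _ (F.filter_le_mem_lows j) (by simp)

theorem label_lt_iff (F : PermFace n m) {i j : Fin n} :
    F.label i < F.label j ↔ ∃ A ∈ F.lows, i ∈ A ∧ j ∉ A := by
  rw [← not_le, label_le_iff]
  push Not
  rfl

theorem lows_isChain (F : PermFace n m) {A B : Finset (Fin n)} (hA : A ∈ F.lows)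
    (hB : B ∈ F.lows) : A ⊆ B ∨ B ⊆ A := by
  by_contra! h
  obtain ⟨i, hiA, hiB⟩ := Finset.not_subset.1 h.1
  obtain ⟨j, hjB, hjA⟩ := Finset.not_subset.1 h.2
  rcases le_total (F.label i) (F.label j) with hij | hij
  · exact hiB (mem_lows.1 hB j hjB i hij)
  · exact hjA (mem_lows.1 hA i hiA j hij)

theorem refines_iff {F : PermFace n m} {F' : PermFace n k} :
    F.Refines F' ↔ F'.lows ⊆ F.lows := by
  constructor
  · intro h A hA
    rw [mem_lows] at hA ⊢
    exact fun i hi j hj => hA i hi j (h _ _ hj)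
  · intro h i j hij
    rw [label_le_iff] at hij ⊢
    exact fun A hA => hij A (h hA)

theorem Refines.label_lt {F : PermFace n m} {F' : PermFace n k} (h : F.Refines F') {i j : Fin n}
    (hij : F'.label i < F'.label j) : F.label i < F.label j :=
  lt_of_not_ge fun hji => absurd (h j i hji) (not_le.mpr hij)

/-- The `p` blocks have `p + 1` initial unions, the empty one included, so the dimension can be read
off from the length of the chain. -/
theorem card_lows (F : PermFace n m) : F.lows.card + m = n + 1 := by
  have h : F.lows = Finset.univ.image fun t : Fin (F.numBlocks + 1) =>
      (Finset.univ.filter fun i => (F.label i : ℕ) < t : Finset (Fin n)) := by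
    ext A
    rw [mem_lows]
    simp only [Finset.mem_image, Finset.mem_univ, true_and]
    constructor
    · intro hA
      rcases A.eq_empty_or_nonempty with rfl | hne
      · exact ⟨0, by simp⟩
      · obtain ⟨i, hi, hmax⟩ := A.exists_max_image F.label hne
        refine ⟨(F.label i).succ, ?_⟩
        ext j
        simp only [Finset.mem_filter, Finset.mem_univ, true_and, Fin.val_succ]
        constructor
        · intro hj
          exact hA i hi j (by rw [Fin.le_def]; omega)
        · intro hj
          have := hmax j hj
          rw [Fin.le_def] at this
          omega
    · rintro ⟨t, rfl⟩ i hi j hj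
      simp only [Finset.mem_filter, Finset.mem_univ, true_and, Fin.le_def] at *
      omega
  rw [h, Finset.card_image_of_injective, Finset.card_univ, Fintype.card_fin]
  · have := F.dim_eq
    omega
  · have key : ∀ s t : Fin (F.numBlocks + 1), s < t →
        (Finset.univ.filter fun i => (F.label i : ℕ) < s : Finset (Fin n)) ≠
          Finset.univ.filter fun i => (F.label i : ℕ) < t := by
      intro s t hst heq
      have hs : (s : ℕ) < F.numBlocks := by have := t.2; rw [Fin.lt_def] at hst; omega
      obtain ⟨i, hi⟩ := F.surj ⟨s, hs⟩
      have : i ∈ (Finset.univ.filter fun i => (F.label i : ℕ) < t : Finset (Fin n)) := by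
        simpa [hi] using hst
      rw [← heq] at this
      simp [hi] at this
    intro s t hst
    rcases lt_trichotomy s t with h | h | h
    · exact absurd hst (key _ _ h)
    · exact h
    · exact absurd hst.symm (key _ _ h)

theorem eq_of_lows_eq {F F' : PermFace n m} (h : F.lows = F'.lows) : F = F' := by
  have hle : ∀ i j, F.label i ≤ F.label j ↔ F'.label i ≤ F'.label j := by
    intro i j
    rw [label_le_iff, label_le_iff, h]
  obtain ⟨p, f, hf, hp⟩ := F
  obtain ⟨q, g, hg, hq⟩ := F'
  obtain rfl : p = q := by omega
  simp only at hle
  have hi : ∀ x, g (Function.surjInv hf (f x)) = g x := by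
    intro x
    have e := Function.surjInv_eq hf (f x)
    exact le_antisymm ((hle _ _).1 e.le) ((hle _ _).1 e.ge)
  have hφ : StrictMono fun s => g (Function.surjInv hf s) := by
    intro s t hst
    rw [← not_le] at hst ⊢
    simpa [← hle, Function.surjInv_eq hf] using hst
  -- The two labelings differ by a strictly increasing self-map of `Fin p`, which can only be the
  -- identity.
  have hid : (fun s => g (Function.surjInv hf s)) = id := by
    refine (StrictMono.range_inj hφ strictMono_id).1 ?_
    rw [Set.range_id, (Finite.surjective_of_injective hφ.injective).range_eq]
  have : f = g := by
    funext x
    rw [← hi x]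
    exact (congrFun hid (f x)).symm
  subst this
  rfl

theorem exists_of_key (g : Fin n → ℕ) :
    ∃ (m : ℕ) (F : PermFace n m), ∀ i j, F.label i ≤ F.label j ↔ g i ≤ g j := by
  set I := Finset.univ.image g with hI
  have hmem : ∀ i, g i ∈ I := fun i => Finset.mem_image_of_mem _ (Finset.mem_univ _)
  have hcard : I.card ≤ n := by simpa using Finset.card_image_le (s := Finset.univ) (f := g)
  let e := I.orderIsoOfFin rfl
  refine ⟨n - I.card, ⟨I.card, fun i => e.symm ⟨g i, hmem i⟩, ?_, by omega⟩, ?_⟩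
  · intro t
    obtain ⟨i, -, hi⟩ := Finset.mem_image.1 (e t).2
    refine ⟨i, ?_⟩
    rw [OrderIso.symm_apply_eq]
    exact Subtype.ext hi
  · intro i j
    simp

theorem exists_of_chain (C : Finset (Finset (Fin n))) (h0 : ∅ ∈ C) (h1 : Finset.univ ∈ C)
    (hC : ∀ A ∈ C, ∀ B ∈ C, A ⊆ B ∨ B ⊆ A) :
    ∃ (m : ℕ) (F : PermFace n m), F.lows = C := by
  -- The key of an index counts the members of the chain that miss it: the later an index enters the
  -- chain, the larger its key.
  obtain ⟨m, F, hF⟩ := exists_of_key fun i => (C.filter fun A => i ∉ A).card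
  have hle : ∀ i j, F.label i ≤ F.label j ↔ ∀ A ∈ C, j ∈ A → i ∈ A := by
    intro i j
    rw [hF]
    constructor
    · intro h A hA hj
      by_contra hi
      refine absurd h (not_le.2 (Finset.card_lt_card ?_))
      refine Finset.ssubset_iff_subset_ne.2 ⟨?_, ?_⟩
      · intro B hB
        simp only [Finset.mem_filter] at hB ⊢
        refine ⟨hB.1, fun hiB => ?_⟩
        rcases hC A hA B hB.1 with hAB | hAB
        · exact hB.2 (hAB hj)
        · exact hi (hAB hiB)
      · intro heq
        have : A ∈ C.filter fun A => i ∉ A := Finset.mem_filter.2 ⟨hA, hi⟩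
        rw [← heq] at this
        exact (Finset.mem_filter.1 this).2 hj
    · intro h
      refine Finset.card_le_card ?_
      intro A hA
      simp only [Finset.mem_filter] at hA ⊢
      exact ⟨hA.1, fun hj => hA.2 (h A hA.1 hj)⟩
  refine ⟨m, F, ?_⟩
  ext A
  rw [mem_lows]
  constructor
  · intro hA
    rcases A.eq_empty_or_nonempty with rfl | hne
    · exact h0
    obtain ⟨i, hi, hmax⟩ := A.exists_max_image F.label hne
    -- An initial union is determined by an element `i` of its last block: it is the smallest member
    -- of the chain containing `i`.
    obtain ⟨B, hB, hmin⟩ := (C.filter fun B => i ∈ B).exists_min_image Finset.card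
      ⟨Finset.univ, by simp [h1]⟩
    rw [Finset.mem_filter] at hB
    have hsub : ∀ D ∈ C, i ∈ D → B ⊆ D := by
      intro D hD hiD
      rcases hC B hB.1 D hD with h | h
      · exact h
      · rw [Finset.eq_of_subset_of_card_le h (hmin D (Finset.mem_filter.2 ⟨hD, hiD⟩))]
    have : A = B := by
      ext j
      constructor
      · intro hj
        exact (hle j i).1 (hmax j hj) B hB.1 hB.2
      · intro hj
        exact hA i hi j ((hle j i).2 fun D hD hiD => hsub D hD hiD hj)
    rw [this]
    exact hB.1
  · intro hA i hi j hj
    exact (hle j i).1 hj A hA hi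

/-- A face of codimension one is cut out by one additional initial union of blocks. -/
theorem Refines.exists_lows_eq_insert {F : PermFace n m} {F' : PermFace n (m + 1)}
    (h : F.Refines F') : ∃ A, A ∉ F'.lows ∧ F.lows = insert A F'.lows := by
  have h1 := F.card_lows
  have h2 := F'.card_lows
  obtain ⟨A, hA⟩ := Finset.card_eq_one.1
    (show (F.lows \ F'.lows).card = 1 by
      rw [Finset.card_sdiff_of_subset (refines_iff.1 h)]; omega)
  have hA' : A ∈ F.lows \ F'.lows := by simp [hA]
  refine ⟨A, (Finset.mem_sdiff.1 hA').2, ?_⟩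
  rw [Finset.insert_eq, ← hA, Finset.sdiff_union_of_subset (refines_iff.1 h)]

theorem exists_erase {F : PermFace n m} {A : Finset (Fin n)} (hA : A ∈ F.lows)
    (h0 : A ≠ ∅) (h1 : A ≠ Finset.univ) :
    ∃ F' : PermFace n (m + 1), F'.lows = F.lows.erase A := by
  obtain ⟨k, F', h⟩ := exists_of_chain (F.lows.erase A)
    (Finset.mem_erase.2 ⟨h0.symm, F.empty_mem_lows⟩)
    (Finset.mem_erase.2 ⟨h1.symm, F.univ_mem_lows⟩)
    (fun B hB D hD => F.lows_isChain (Finset.mem_of_mem_erase hB) (Finset.mem_of_mem_erase hD))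
  have c1 := F.card_lows
  have c2 := F'.card_lows
  have c3 := Finset.card_erase_add_one hA
  rw [h] at c2
  obtain rfl : k = m + 1 := by omega
  exact ⟨F', h⟩

theorem exists_insert {F : PermFace n m} {A : Finset (Fin n)} (hA : A ∉ F.lows)
    (hC : ∀ B ∈ F.lows, A ⊆ B ∨ B ⊆ A) :
    ∃ (k : ℕ) (F' : PermFace n k), k + 1 = m ∧ F'.lows = insert A F.lows := by
  obtain ⟨k, F', h⟩ := exists_of_chain (insert A F.lows)
    (Finset.mem_insert_of_mem F.empty_mem_lows)
    (Finset.mem_insert_of_mem F.univ_mem_lows)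
    (by
      intro B hB D hD
      rcases Finset.mem_insert.1 hB with hB | hB <;> rcases Finset.mem_insert.1 hD with hD | hD
      · exact Or.inl (hB.trans hD.symm).subset
      · exact hB ▸ hC _ hD
      · exact hD ▸ (hC _ hB).symm
      · exact F.lows_isChain hB hD)
  have c1 := F.card_lows
  have c2 := F'.card_lows
  rw [h, Finset.card_insert_of_notMem hA] at c2
  exact ⟨k, F', by omega, h⟩

end PermFace

/-! ### The acyclic matching -/

namespace PermFace

variable {n m k : ℕ} {ρ : Equiv.Perm (Fin n)}

/-- Two faces agree on the pairs increasing for `ρ`: the block of `i` precedes the block of `j` in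
both of them or in none. -/
def SameAscents (ρ : Equiv.Perm (Fin n)) (F : PermFace n m) (G : PermFace n k) : Prop :=
  ∀ i j, ρ i < ρ j → (F.label i < F.label j ↔ G.label i < G.label j)

theorem SameAscents.symm {F : PermFace n m} {G : PermFace n k} (h : SameAscents ρ F G) :
    SameAscents ρ G F := fun i j hij => (h i j hij).symm

/-- The number of pairs, increasing for `ρ`, whose blocks are in the same order. -/
def ascents (ρ : Equiv.Perm (Fin n)) (F : PermFace n m) : ℕ :=
  (Finset.univ.filter fun z : Fin n × Fin n => ρ z.1 < ρ z.2 ∧ F.label z.1 < F.label z.2).card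

theorem SameAscents.ascents_eq {F : PermFace n m} {G : PermFace n k} (h : SameAscents ρ F G) :
    F.ascents ρ = G.ascents ρ := by
  unfold ascents
  congr 1
  ext z
  simp only [Finset.mem_filter, Finset.mem_univ, true_and, and_congr_right_iff]
  exact h z.1 z.2

theorem Refines.filter_subset {F : PermFace n m} {G : PermFace n k} (h : F.Refines G) :
    (Finset.univ.filter fun z : Fin n × Fin n => ρ z.1 < ρ z.2 ∧ G.label z.1 < G.label z.2) ⊆
      Finset.univ.filter fun z : Fin n × Fin n => ρ z.1 < ρ z.2 ∧ F.label z.1 < F.label z.2 := by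
  intro z
  simp only [Finset.mem_filter, Finset.mem_univ, true_and]
  exact fun hz => ⟨hz.1, h.label_lt hz.2⟩

theorem Refines.sameAscents {F : PermFace n m} {G : PermFace n k} (h : F.Refines G)
    (hr : F.ascents ρ ≤ G.ascents ρ) : SameAscents ρ F G := by
  intro i j hij
  have := Finset.eq_of_subset_of_card_le (h.filter_subset (ρ := ρ)) hr
  have := Finset.ext_iff.1 this (i, j)
  simpa [hij] using this.symm

/-- The pivot of a face is the `ρ`-largest index whose block does not come after the blocks of all
`ρ`-smaller indices. -/
def IsPivot (ρ : Equiv.Perm (Fin n)) (F : PermFace n m) (a : Fin n) : Prop :=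
  (∃ i, ρ i < ρ a ∧ ¬ F.label i < F.label a) ∧
    ∀ j, ρ a < ρ j → ∀ i, ρ i < ρ j → F.label i < F.label j

/-- The union of the blocks before the block of `a`, together with `a`. -/
def pivotSet (F : PermFace n m) (a : Fin n) : Finset (Fin n) :=
  Finset.univ.filter fun i => F.label i < F.label a ∨ i = a

theorem mem_pivotSet {F : PermFace n m} {a i : Fin n} :
    i ∈ F.pivotSet a ↔ F.label i < F.label a ∨ i = a := by simp [pivotSet]

theorem IsPivot.unique {F : PermFace n m} {a b : Fin n} (ha : IsPivot ρ F a)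
    (hb : IsPivot ρ F b) : a = b := by
  rcases lt_trichotomy (ρ a) (ρ b) with h | h | h
  · obtain ⟨i, hi, hl⟩ := hb.1
    exact absurd (ha.2 b h i hi) hl
  · exact ρ.injective h
  · obtain ⟨i, hi, hl⟩ := ha.1
    exact absurd (hb.2 a h i hi) hl

theorem exists_isPivot (F : PermFace n m) {i j : Fin n} (hij : ρ i < ρ j)
    (h : ¬ F.label i < F.label j) : ∃ a, IsPivot ρ F a := by
  obtain ⟨a, ha, hmax⟩ := (Finset.univ.filter fun a =>
    ∃ i, ρ i < ρ a ∧ ¬ F.label i < F.label a).exists_max_image ρ ⟨j, by simpa using ⟨i, hij, not_lt.1 h⟩⟩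
  refine ⟨a, by simpa using ha, fun b hb c hc => ?_⟩
  by_contra hcb
  exact absurd hb (not_lt.2 (hmax b (by simpa using ⟨c, hc, not_lt.1 hcb⟩)))

theorem IsPivot.congr {F : PermFace n m} {G : PermFace n k} {a : Fin n} (ha : IsPivot ρ F a)
    (h : SameAscents ρ F G) : IsPivot ρ G a := by
  obtain ⟨⟨i, hi, hl⟩, h2⟩ := ha
  exact ⟨⟨i, hi, by rwa [← h i a hi]⟩, fun j hj i hi => (h i j hi).1 (h2 j hj i hi)⟩

/-- Only comparisons with `a` matter: those of `ρ`-smaller indices are recorded by the ascents, and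
every `ρ`-larger index comes after the pivot in both faces. -/
theorem IsPivot.pivotSet_eq {F : PermFace n m} {G : PermFace n k} {a : Fin n}
    (ha : IsPivot ρ F a) (h : SameAscents ρ F G) : F.pivotSet a = G.pivotSet a := by
  ext i
  rw [mem_pivotSet, mem_pivotSet]
  rcases lt_trichotomy (ρ i) (ρ a) with hi | hi | hi
  · rw [h i a hi]
  · simp [ρ.injective hi]
  · have h1 := ha.2 i hi a hi
    have h2 := (h a i hi).1 h1
    simp [h1.not_gt, h2.not_gt]

/-- The set lies between two consecutive initial unions, the ones just before and just after the
block of `a`. -/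
theorem pivotSet_isChain (F : PermFace n m) (a : Fin n) {B : Finset (Fin n)} (hB : B ∈ F.lows) :
    F.pivotSet a ⊆ B ∨ B ⊆ F.pivotSet a := by
  rw [mem_lows] at hB
  by_cases ha : a ∈ B
  · left
    intro i hi
    rcases mem_pivotSet.1 hi with h | rfl
    · exact hB a ha i h.le
    · exact ha
  · right
    intro i hi
    rw [mem_pivotSet]
    left
    by_contra h
    exact ha (hB i hi a (not_lt.1 h))

/-- Splitting `a` off its block newly separates only pairs `(a, j)`; when `ρ a < ρ j`, the pivot
property says that they were separated already. -/
theorem IsPivot.sameAscents_of_insert {F : PermFace n m} {G : PermFace n k} {a : Fin n}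
    (ha : IsPivot ρ F a) (h : G.lows = insert (F.pivotSet a) F.lows) : SameAscents ρ F G := by
  intro i j hij
  have hr : G.Refines F := refines_iff.2 (h ▸ Finset.subset_insert _ _)
  refine ⟨hr.label_lt, fun hl => ?_⟩
  obtain ⟨A, hA, hi, hj⟩ := label_lt_iff _ |>.1 hl
  rw [h] at hA
  rcases Finset.mem_insert.1 hA with rfl | hA
  · rw [mem_pivotSet] at hi hj
    push Not at hj
    rcases hi with hi | rfl
    · exact hi.trans_le hj.1
    · exact ha.2 j hij i hij
  · exact (label_lt_iff _).2 ⟨A, hA, hi, hj⟩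

/-- The only ascents in danger are `(a, j)` with `ρ a < ρ j`. Some `ρ`-smaller `t` does not precede
`a`, and it precedes `j` because `a` is the pivot; the initial union ending at the block of `t`
therefore still separates `a` from `j`. -/
theorem IsPivot.sameAscents_of_erase {F : PermFace n m} {G : PermFace n k} {a : Fin n}
    (ha : IsPivot ρ F a) (h : G.lows = F.lows.erase (F.pivotSet a))
    (hb : F.pivotSet a ∈ F.lows) : SameAscents ρ F G := by
  intro i j hij
  have hr : F.Refines G := refines_iff.2 (h ▸ Finset.erase_subset _ _)
  refine ⟨fun hl => ?_, hr.label_lt⟩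
  obtain ⟨A, hA, hi, hj⟩ := label_lt_iff _ |>.1 hl
  have haA : a ∈ F.pivotSet a := mem_pivotSet.2 (Or.inr rfl)
  rcases eq_or_ne A (F.pivotSet a) with rfl | hne
  · rw [mem_pivotSet] at hi
    rcases hi with hi | rfl
    · obtain ⟨B, hB, hiB, haB⟩ := label_lt_iff _ |>.1 hi
      refine (label_lt_iff _).2 ⟨B, ?_, hiB, fun hjB => hj ?_⟩
      · rw [h]
        exact Finset.mem_erase.2 ⟨fun e => haB (e ▸ haA), hB⟩
      · exact mem_pivotSet.2 (Or.inl ((label_lt_iff _).2 ⟨B, hB, hjB, haB⟩))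
    · obtain ⟨t, ht, htl⟩ := ha.1
      have htj := ha.2 j hij t (ht.trans hij)
      refine (label_lt_iff _).2 ⟨Finset.univ.filter fun j => F.label j ≤ F.label t,
        ?_, ?_, ?_⟩
      · rw [h]
        refine Finset.mem_erase.2 ⟨fun e => ?_, F.filter_le_mem_lows t⟩
        have : t ∈ F.pivotSet i := by rw [← e]; simp
        rcases mem_pivotSet.1 this with h' | rfl
        · exact htl h'
        · exact lt_irrefl _ ht
      · simpa using htl
      · simpa using htj
  · exact (label_lt_iff _).2 ⟨A, by rw [h]; exact Finset.mem_erase.2 ⟨hne, hA⟩, hi, hj⟩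

/-- The pivot of `F` is a block by itself. -/
def IsLower (ρ : Equiv.Perm (Fin n)) (F : PermFace n m) : Prop :=
  ∃ a, IsPivot ρ F a ∧ F.pivotSet a ∈ F.lows

/-- The pivot of `F` is not a block by itself. -/
def IsUpper (ρ : Equiv.Perm (Fin n)) (F : PermFace n m) : Prop :=
  ∃ a, IsPivot ρ F a ∧ F.pivotSet a ∉ F.lows

theorem IsLower.not_isUpper {F : PermFace n m} (h : IsLower ρ F) : ¬ IsUpper ρ F := by
  obtain ⟨a, ha, hl⟩ := h
  rintro ⟨b, hb, hu⟩
  rw [hb.unique ha] at hu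
  exact hu hl

/-- The acyclic matching of the faces: `U` is obtained from `F` by merging the block of the pivot
with the next one. -/
def Matched (ρ : Equiv.Perm (Fin n)) (F : PermFace n m) (U : PermFace n (m + 1)) : Prop :=
  ∃ a, IsPivot ρ F a ∧ F.pivotSet a ∈ F.lows ∧ U.lows = F.lows.erase (F.pivotSet a)

theorem Matched.isLower {F : PermFace n m} {U : PermFace n (m + 1)} (h : Matched ρ F U) :
    IsLower ρ F := by
  obtain ⟨a, h1, h2, -⟩ := h
  exact ⟨a, h1, h2⟩

theorem Matched.refines {F : PermFace n m} {U : PermFace n (m + 1)} (h : Matched ρ F U) :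
    F.Refines U := by
  obtain ⟨a, -, -, h⟩ := h
  exact refines_iff.2 (h ▸ Finset.erase_subset _ _)

theorem Matched.sameAscents {F : PermFace n m} {U : PermFace n (m + 1)} (h : Matched ρ F U) :
    SameAscents ρ F U := by
  obtain ⟨a, h1, h2, h3⟩ := h
  exact h1.sameAscents_of_erase h3 h2

theorem Matched.isUpper {F : PermFace n m} {U : PermFace n (m + 1)} (h : Matched ρ F U) :
    IsUpper ρ U := by
  have hs := h.sameAscents
  obtain ⟨a, h1, h2, h3⟩ := h
  exact ⟨a, h1.congr hs, by rw [← h1.pivotSet_eq hs, h3]; simp⟩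

theorem IsLower.exists_matched {F : PermFace n m} (h : IsLower ρ F) :
    ∃ U : PermFace n (m + 1), Matched ρ F U := by
  obtain ⟨a, ha, hl⟩ := h
  obtain ⟨U, hU⟩ := exists_erase hl
    (Finset.ne_empty_of_mem (mem_pivotSet.2 (Or.inr rfl) : a ∈ F.pivotSet a)) (by
      intro h
      obtain ⟨i, hi, hil⟩ := ha.1
      have : i ∈ F.pivotSet a := by rw [h]; simp
      rcases mem_pivotSet.1 this with h' | rfl
      · exact hil h'
      · exact lt_irrefl _ hi)
  exact ⟨U, a, ha, hl, hU⟩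

theorem IsUpper.exists_matched {U : PermFace n (m + 1)} (h : IsUpper ρ U) :
    ∃ F : PermFace n m, Matched ρ F U := by
  obtain ⟨a, ha, hl⟩ := h
  obtain ⟨k, F, hk, hF⟩ := exists_insert hl fun B hB => U.pivotSet_isChain a hB
  obtain rfl : k = m := by omega
  have hs := ha.sameAscents_of_insert hF
  refine ⟨F, a, ha.congr hs, ?_, ?_⟩
  · rw [← ha.pivotSet_eq hs, hF]
    simp
  · rw [← ha.pivotSet_eq hs, hF, Finset.erase_insert hl]

theorem not_isUpper_zero (F : PermFace n 0) : ¬ IsUpper ρ F := by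
  rintro ⟨a, ha, hl⟩
  obtain ⟨k, G, hk, -⟩ := exists_insert hl fun B hB => F.pivotSet_isChain a hB
  omega

theorem Matched.right_unique {F : PermFace n m} {U U' : PermFace n (m + 1)} (h : Matched ρ F U)
    (h' : Matched ρ F U') : U = U' := by
  obtain ⟨a, ha, -, h⟩ := h
  obtain ⟨b, hb, -, h'⟩ := h'
  rw [hb.unique ha] at h'
  exact eq_of_lows_eq (h.trans h'.symm)

/-- The matching is acyclic. -/
theorem Matched.ascents_lt {F G : PermFace n m} {U : PermFace n (m + 1)} (h : Matched ρ F U)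
    (hG : IsLower ρ G) (hr : G.Refines U) (hne : G ≠ F) : F.ascents ρ < G.ascents ρ := by
  by_contra hle
  rw [not_lt, h.sameAscents.ascents_eq] at hle
  -- Refinement can only add ascents, so without a strict gain `G`, `U` and `F` have the same
  -- ascents. They then share the pivot and its set, and the one set that `G` adds to the chain of
  -- `U` must be this set, which forces `G = F`.
  have hs := hr.sameAscents hle
  have hsF := h.sameAscents
  obtain ⟨a, ha, h1, h2⟩ := h
  obtain ⟨b, hb, hb1⟩ := hG
  have haU := ha.congr hsF
  obtain rfl : b = a := (hb.congr hs).unique haU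
  have e : G.pivotSet b = F.pivotSet b := by rw [hb.pivotSet_eq hs, ha.pivotSet_eq hsF]
  obtain ⟨A, hA, hGA⟩ := hr.exists_lows_eq_insert
  rw [e, hGA] at hb1
  have hAe : F.pivotSet b = A := by
    refine (Finset.mem_insert.1 hb1).resolve_right ?_
    rw [h2]
    simp
  refine hne (eq_of_lows_eq ?_)
  rw [hGA, h2, ← hAe, Finset.insert_erase h1]

theorem Matched.left_unique {F F' : PermFace n m} {U : PermFace n (m + 1)} (h : Matched ρ F U)
    (h' : Matched ρ F' U) : F = F' := by
  by_contra hne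
  have h1 := h.ascents_lt h'.isLower h'.refines (Ne.symm hne)
  have h2 := h'.ascents_lt h.isLower h.refines hne
  exact lt_asymm h1 h2

/-- The vertex whose blocks are ordered by `ρ`. -/
def vertexFace (ρ : Equiv.Perm (Fin n)) : PermFace n 0 := ⟨n, ρ, ρ.surjective, rfl⟩

theorem not_isPivot_vertexFace (a : Fin n) : ¬ IsPivot ρ (vertexFace ρ) a := by
  rintro ⟨⟨i, hi, hl⟩, -⟩
  exact hl hi

/-- A face that is neither lower nor upper has no pivot, so its blocks order all indices exactly as
`ρ` does. -/
theorem lows_eq_vertexFace {F : PermFace n m} (h1 : ¬ IsLower ρ F) (h2 : ¬ IsUpper ρ F) :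
    F.lows = (vertexFace ρ).lows := by
  have h : ∀ i j, ρ i < ρ j → F.label i < F.label j := by
    intro i j hij
    by_contra hl
    obtain ⟨a, ha⟩ := F.exists_isPivot hij hl
    by_cases hs : F.pivotSet a ∈ F.lows
    · exact h1 ⟨a, ha, hs⟩
    · exact h2 ⟨a, ha, hs⟩
  have hle : ∀ i j, F.label i ≤ F.label j ↔ (vertexFace ρ).label i ≤ (vertexFace ρ).label j := by
    intro i j
    change _ ↔ ρ i ≤ ρ j
    refine ⟨fun hl => ?_, fun hl => ?_⟩
    · by_contra hij
      exact absurd (h j i (not_le.1 hij)) (not_lt.2 hl)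
    · rcases hl.lt_or_eq with hl | hl
      · exact (h _ _ hl).le
      · rw [ρ.injective hl]
  ext A
  simp only [mem_lows, hle]

end PermFace

/-! ### The permutohedron by inequalities -/

/-- The amount by which `x` satisfies the inequality `∑ i ∈ A, x i ≥ 1 + 2 + ⋯ + |A|` of the
permutohedron. -/
noncomputable def slack {n : ℕ} (A : Finset (Fin n)) (x : Fin n → ℝ) : ℝ :=
  ∑ i ∈ A, x i - (A.card : ℝ) * (A.card + 1) / 2

section Slack

variable {n : ℕ}

theorem slack_add_smul (A : Finset (Fin n)) (x v : Fin n → ℝ) (t : ℝ) :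
    slack A (x + t • v) = slack A x + t * ∑ i ∈ A, v i := by
  simp only [slack, Pi.add_apply, Pi.smul_apply, smul_eq_mul, Finset.sum_add_distrib,
    ← Finset.mul_sum]
  ring

theorem sum_sub_eq_slack_sub (A : Finset (Fin n)) (x y : Fin n → ℝ) :
    ∑ i ∈ A, (x - y) i = slack A x - slack A y := by
  simp [slack]

theorem slack_convexComb (A : Finset (Fin n)) (x y : Fin n → ℝ) {a b : ℝ} (hab : a + b = 1) :
    slack A (a • x + b • y) = a * slack A x + b * slack A y := by
  simp only [slack, Pi.add_apply, Pi.smul_apply, smul_eq_mul, Finset.sum_add_distrib,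
    ← Finset.mul_sum]
  linear_combination ((A.card : ℝ) * (A.card + 1) / 2) * hab

theorem continuous_slack (A : Finset (Fin n)) : Continuous (slack A) := by
  unfold slack
  fun_prop

theorem slack_empty (x : Fin n → ℝ) : slack ∅ x = 0 := by simp [slack]

/-- The polytope given by the inequalities of the permutohedron. -/
def permPolytope (n : ℕ) : Set (Fin n → ℝ) := {x | (∀ A, 0 ≤ slack A x) ∧ slack Finset.univ x = 0}

theorem convex_permPolytope : Convex ℝ (permPolytope n) := by
  intro x hx y hy a b ha hb hab
  refine ⟨fun A => ?_, ?_⟩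
  · rw [slack_convexComb A x y hab]
    exact add_nonneg (mul_nonneg ha (hx.1 A)) (mul_nonneg hb (hy.1 A))
  · rw [slack_convexComb _ x y hab, hx.2, hy.2]
    ring

/-- The tight inequalities at a point of the permutohedron form a chain. -/
theorem tight_isChain {x : Fin n → ℝ} (hx : x ∈ permPolytope n) {A B : Finset (Fin n)}
    (hA : slack A x = 0) (hB : slack B x = 0) : A ⊆ B ∨ B ⊆ A := by
  have h1 := hx.1 (A ∩ B)
  have h2 := hx.1 (A ∪ B)
  have h3 : ∑ i ∈ A ∪ B, x i + ∑ i ∈ A ∩ B, x i = ∑ i ∈ A, x i + ∑ i ∈ B, x i :=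
    Finset.sum_union_inter
  have hca : ((A \ B).card : ℝ) + (A ∩ B).card = A.card := by
    exact_mod_cast Finset.card_sdiff_add_card_inter A B
  have hcb : ((B \ A).card : ℝ) + (A ∩ B).card = B.card := by
    rw [Finset.inter_comm]
    exact_mod_cast Finset.card_sdiff_add_card_inter B A
  have hcu : ((A ∪ B).card : ℝ) + (A ∩ B).card = A.card + B.card := by
    exact_mod_cast Finset.card_union_add_card_inter A B
  -- The bound `k(k+1)/2` is strictly supermodular: its values at `A ∪ B` and `A ∩ B` exceed those
  -- at `A` and `B` by `|A \ B| * |B \ A|` in total, while the coordinate sums balance.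
  have h4 : ((A \ B).card : ℝ) * (B \ A).card ≤ 0 := by
    unfold slack at *
    set a : ℝ := ((A \ B).card : ℝ)
    set b : ℝ := ((B \ A).card : ℝ)
    set c : ℝ := ((A ∩ B).card : ℝ)
    have hu : ((A ∪ B).card : ℝ) = a + b + c := by linarith
    rw [hu] at h2
    rw [← hca] at hA
    rw [← hcb] at hB
    linarith
  have h5 : ((A \ B).card : ℝ) * (B \ A).card = 0 := le_antisymm h4 (by positivity)
  rcases mul_eq_zero.1 h5 with h | h
  · left
    simpa [Finset.sdiff_eq_empty_iff_subset] using h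
  · right
    simpa [Finset.sdiff_eq_empty_iff_subset] using h

open Classical in
theorem exists_face_tight {x : Fin n → ℝ} (hx : x ∈ permPolytope n) :
    ∃ (m : ℕ) (G : PermFace n m), ∀ A, A ∈ G.lows ↔ slack A x = 0 := by
  obtain ⟨m, G, hG⟩ := PermFace.exists_of_chain (Finset.univ.filter fun A => slack A x = 0)
    (by simp [slack_empty]) (by simp [hx.2]) (fun A hA B hB =>
      tight_isChain hx (Finset.mem_filter.1 hA).2 (Finset.mem_filter.1 hB).2)
  exact ⟨m, G, fun A => by simp [hG]⟩

/-- The barycenter of the vertices compatible with the preorder defined by `g`. -/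
noncomputable def baryOfKey {β : Type*} [LinearOrder β] (g : Fin n → β) (i : Fin n) : ℝ :=
  1 / 2 + 1 / 2 * ∑ j, ((if g j < g i then 1 else 0) + (if g j ≤ g i then 1 else 0))

/-- The contributions of a pair inside `A`, taken in both orders, add up to 2 whatever `g` is. They
cancel the constant in the slack, and only the pairs crossing out of `A` remain. -/
theorem slack_baryOfKey {β : Type*} [LinearOrder β] (g : Fin n → β) (A : Finset (Fin n)) :
    slack A (baryOfKey g) = 1 / 2 * ∑ i ∈ A, ∑ j ∈ Aᶜ,
      ((if g j < g i then 1 else 0) + (if g j ≤ g i then 1 else 0) : ℝ) := by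
  set c : Fin n → Fin n → ℝ :=
    fun i j => (if g j < g i then 1 else 0) + (if g j ≤ g i then 1 else 0) with hc
  have h1 : ∀ i j, c i j + c j i = 2 := by
    intro i j
    rcases lt_trichotomy (g i) (g j) with h | h | h
    · simp [hc, h, h.le, h.not_gt, h.not_ge]; norm_num
    · simp [hc, h]; norm_num
    · simp [hc, h, h.le, h.not_gt, h.not_ge]; norm_num
  have h2 : ∑ i ∈ A, ∑ j ∈ A, c i j = (A.card : ℝ) ^ 2 := by
    have : ∑ i ∈ A, ∑ j ∈ A, c i j + ∑ i ∈ A, ∑ j ∈ A, c i j = 2 * (A.card : ℝ) ^ 2 := by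
      nth_rewrite 2 [Finset.sum_comm]
      simp only [← Finset.sum_add_distrib, h1, Finset.sum_const, nsmul_eq_mul]
      ring
    linarith
  have h3 : ∀ i, baryOfKey g i = 1 / 2 + 1 / 2 * (∑ j ∈ A, c i j + ∑ j ∈ Aᶜ, c i j) := by
    intro i
    rw [Finset.sum_add_sum_compl]
    rfl
  change _ = 1 / 2 * ∑ i ∈ A, ∑ j ∈ Aᶜ, c i j
  simp only [slack, h3, Finset.sum_add_distrib, ← Finset.mul_sum, h2, Finset.sum_const,
    nsmul_eq_mul]
  ring

theorem slack_baryOfKey_nonneg {β : Type*} [LinearOrder β] (g : Fin n → β) (A : Finset (Fin n)) :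
    0 ≤ slack A (baryOfKey g) := by
  rw [slack_baryOfKey]
  refine mul_nonneg (by norm_num) (Finset.sum_nonneg fun i _ => Finset.sum_nonneg fun j _ => ?_)
  split_ifs <;> norm_num

theorem slack_baryOfKey_eq_zero_iff {β : Type*} [LinearOrder β] (g : Fin n → β)
    (A : Finset (Fin n)) :
    slack A (baryOfKey g) = 0 ↔ ∀ i ∈ A, ∀ j, g j ≤ g i → j ∈ A := by
  have hnn : ∀ i j, (0 : ℝ) ≤ (if g j < g i then 1 else 0) + (if g j ≤ g i then 1 else 0) := by
    intro i j
    split_ifs <;> norm_num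
  rw [slack_baryOfKey, mul_eq_zero_iff_left (by norm_num : (1 / 2 : ℝ) ≠ 0),
    Finset.sum_eq_zero_iff_of_nonneg fun i _ => Finset.sum_nonneg fun j _ => hnn i j]
  refine forall₂_congr fun i _ => ?_
  rw [Finset.sum_eq_zero_iff_of_nonneg fun j _ => hnn i j]
  refine forall_congr' fun j => ?_
  rw [Finset.mem_compl]
  constructor
  · intro h hij
    by_contra hj
    have := h hj
    rw [if_pos hij] at this
    split_ifs at this <;> norm_num at this
  · intro h hj
    have h' : ¬ g j ≤ g i := fun hij => hj (h hij)
    rw [if_neg h', if_neg fun hlt => h' hlt.le, add_zero]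

theorem baryOfKey_mem {β : Type*} [LinearOrder β] (g : Fin n → β) :
    baryOfKey g ∈ permPolytope n :=
  ⟨slack_baryOfKey_nonneg g, (slack_baryOfKey_eq_zero_iff g _).2 (by simp)⟩

theorem permVertex_eq_baryOfKey (σ : Equiv.Perm (Fin n)) : permVertex σ = baryOfKey σ := by
  funext i
  have h1 : ∑ j, (if σ j < σ i then (1 : ℝ) else 0) = (σ i : ℕ) := by
    rw [Equiv.sum_comp σ fun j => if j < σ i then (1 : ℝ) else 0, Finset.sum_boole,
      show (Finset.univ.filter fun j => j < σ i) = Finset.Iio (σ i) by ext; simp, Fin.card_Iio]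
  have h2 : ∑ j, (if σ j ≤ σ i then (1 : ℝ) else 0) = (σ i : ℕ) + 1 := by
    rw [Equiv.sum_comp σ fun j => if j ≤ σ i then (1 : ℝ) else 0, Finset.sum_boole,
      show (Finset.univ.filter fun j => j ≤ σ i) = Finset.Iic (σ i) by ext; simp, Fin.card_Iic]
    push_cast
    rfl
  rw [permVertex, baryOfKey, Finset.sum_add_distrib, h1, h2]
  ring

/-- Moving in the direction of a difference of two coordinate vectors until a new inequality becomes
tight. -/
theorem exists_move {x : Fin n → ℝ} (hx : x ∈ permPolytope n) {i j : Fin n} (hij : i ≠ j)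
    (h : ∀ A, slack A x = 0 → (i ∈ A ↔ j ∈ A)) :
    ∃ t : ℝ, 0 < t ∧ x + t • (Pi.single i 1 - Pi.single j 1 : Fin n → ℝ) ∈ permPolytope n ∧
      (∀ A, slack A x = 0 →
        slack A (x + t • (Pi.single i 1 - Pi.single j 1 : Fin n → ℝ)) = 0) ∧
      ∃ A, slack A x ≠ 0 ∧
        slack A (x + t • (Pi.single i 1 - Pi.single j 1 : Fin n → ℝ)) = 0 := by
  have hs : ∀ A : Finset (Fin n), ∑ l ∈ A, (Pi.single i 1 - Pi.single j 1 : Fin n → ℝ) l =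
      (if i ∈ A then 1 else 0) - (if j ∈ A then 1 else 0) := by
    intro A
    simp
  -- Only sets containing `j` but not `i` lose slack, all at unit rate, so the smallest of these
  -- slacks is the time at which the motion must stop.
  obtain ⟨A₀, hA₀, hmin⟩ := (Finset.univ.filter fun A : Finset (Fin n) =>
    i ∉ A ∧ j ∈ A).exists_min_image (fun A => slack A x) ⟨{j}, by simpa using hij⟩
  rw [Finset.mem_filter] at hA₀
  have hne : slack A₀ x ≠ 0 := fun h0 => hA₀.2.1 ((h A₀ h0).2 hA₀.2.2)
  have hpos : 0 < slack A₀ x := lt_of_le_of_ne (hx.1 A₀) hne.symm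
  have htight : ∀ A, slack A x = 0 → slack A (x + slack A₀ x •
      (Pi.single i 1 - Pi.single j 1 : Fin n → ℝ)) = 0 := by
    intro A hA
    rw [slack_add_smul, hs, hA]
    simp [h A hA]
  refine ⟨slack A₀ x, hpos, ⟨fun A => ?_, htight _ hx.2⟩, htight, A₀, hne, ?_⟩
  · rw [slack_add_smul, hs]
    have h0 := hx.1 A
    by_cases hi : i ∈ A <;> by_cases hj : j ∈ A
    · simpa [hi, hj] using h0
    · simp only [hi, hj, if_true, if_false]
      linarith
    · have := hmin A (by simp [hi, hj])
      simp only [hi, hj, if_true, if_false]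
      linarith
    · simpa [hi, hj] using h0
  · rw [slack_add_smul, hs]
    simp [hA₀.2.1, hA₀.2.2]

end Slack

namespace PermFace

variable {n m k : ℕ}

theorem carrier_subset_permPolytope (F : PermFace n m) :
    F.carrier ⊆ {x ∈ permPolytope n | ∀ A ∈ F.lows, slack A x = 0} := by
  refine convexHull_min ?_ ?_
  · rintro _ ⟨σ, hσ, rfl⟩
    rw [permVertex_eq_baryOfKey]
    refine ⟨baryOfKey_mem _, fun A hA => (slack_baryOfKey_eq_zero_iff _ _).2 fun i hi j hj => ?_⟩
    by_contra hjA
    exact absurd hj (not_le.2 (hσ i j ((label_lt_iff F).2 ⟨A, hA, hi, hjA⟩)))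
  · intro x hx y hy a b ha hb hab
    refine ⟨convex_permPolytope hx.1 hy.1 ha hb hab, fun A hA => ?_⟩
    rw [slack_convexComb A x y hab, hx.2 A hA, hy.2 A hA]
    ring

theorem eq_permVertex_of_injective {x : Fin n → ℝ} (G : PermFace n m)
    (hG : ∀ A ∈ G.lows, slack A x = 0) (hinj : Function.Injective G.label) :
    ∃ σ : Equiv.Perm (Fin n), x = permVertex σ ∧ ∀ i j, σ i < σ j ↔ G.label i < G.label j := by
  obtain ⟨p, f, hf, hp⟩ := G
  have hcard : n = p := by simpa using Fintype.card_of_bijective (f := f) ⟨hinj, hf⟩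
  subst hcard
  refine ⟨Equiv.ofBijective f ⟨hinj, hf⟩, ?_, fun i j => Iff.rfl⟩
  set σ := Equiv.ofBijective f ⟨hinj, hf⟩ with hσ
  funext i
  have hB : slack (Finset.univ.filter fun j => σ j < σ i) x = 0 := by
    refine hG _ (mem_lows.2 fun a ha b hb => ?_)
    simp only [Finset.mem_filter, Finset.mem_univ, true_and] at ha ⊢
    exact lt_of_le_of_lt hb ha
  have hA : slack (Finset.univ.filter fun j => σ j ≤ σ i) x = 0 := by
    refine hG _ (mem_lows.2 fun a ha b hb => ?_)
    simp only [Finset.mem_filter, Finset.mem_univ, true_and] at ha ⊢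
    exact le_trans hb ha
  have hcB : (Finset.univ.filter fun j => σ j < σ i).card = (σ i : ℕ) := by
    rw [show (Finset.univ.filter fun j => σ j < σ i) = (Finset.Iio (σ i)).map σ.symm.toEmbedding by
      ext j; simp [Finset.mem_map_equiv], Finset.card_map, Fin.card_Iio]
  have hins : (Finset.univ.filter fun j => σ j ≤ σ i) =
      insert i (Finset.univ.filter fun j => σ j < σ i) := by
    ext j
    simp [le_iff_eq_or_lt]
  rw [hins] at hA
  unfold slack at hA hB
  rw [Finset.sum_insert (by simp), Finset.card_insert_of_notMem (by simp), hcB] at hA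
  rw [hcB] at hB
  push_cast at hA
  rw [permVertex]
  linarith

open Classical in
/-- The face is cut out of the permutohedron by the inequalities of its initial unions of blocks. -/
theorem mem_carrier_iff {F : PermFace n m} {x : Fin n → ℝ} :
    x ∈ F.carrier ↔ x ∈ permPolytope n ∧ ∀ A ∈ F.lows, slack A x = 0 := by
  refine ⟨fun h => F.carrier_subset_permPolytope h, ?_⟩
  rintro ⟨hx, hF⟩
  -- Induction on the number of inequalities that are not tight. A point with all labels distinct is
  -- a vertex; any other point lies between two points, reached by opposite moves, with more tight
  -- inequalities.
  induction hk : (Finset.univ.filter fun A : Finset (Fin n) => slack A x ≠ 0).card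
    using Nat.strong_induction_on generalizing x with
  | _ k ih =>
  obtain ⟨l, G, hG⟩ := exists_face_tight hx
  by_cases hinj : Function.Injective G.label
  · obtain ⟨σ, rfl, hσ⟩ := G.eq_permVertex_of_injective (fun A hA => (hG A).1 hA) hinj
    refine subset_convexHull ℝ _ ⟨σ, fun i j hij => ?_, rfl⟩
    have hr : G.Refines F := refines_iff.2 fun A hA => (hG A).2 (hF A hA)
    exact (hσ i j).2 (hr.label_lt hij)
  · obtain ⟨i, j, hij, hne⟩ : ∃ i j, G.label i = G.label j ∧ i ≠ j := by
      simpa [Function.Injective] using hinj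
    have key : ∀ i j, i ≠ j → G.label i = G.label j → ∃ t : ℝ, 0 < t ∧
        x + t • (Pi.single i 1 - Pi.single j 1 : Fin n → ℝ) ∈ F.carrier := by
      intro i j hne hij
      obtain ⟨t, ht, hy, htight, A₀, hA₀, hA₀'⟩ := exists_move hx hne fun A hA => by
        have := (hG A).2 hA
        exact ⟨fun h => (label_le_iff G).1 hij.ge A this h,
          fun h => (label_le_iff G).1 hij.le A this h⟩
      refine ⟨t, ht, ih _ ?_ hy (fun A hA => htight A (hF A hA)) rfl⟩
      rw [← hk]
      refine Finset.card_lt_card (Finset.ssubset_iff_subset_ne.2 ⟨fun A hA => ?_, fun heq => ?_⟩)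
      · simp only [Finset.mem_filter, Finset.mem_univ, true_and] at hA ⊢
        exact fun h => hA (htight A h)
      · have : A₀ ∈ Finset.univ.filter fun A : Finset (Fin n) => slack A x ≠ 0 := by simp [hA₀]
        rw [← heq] at this
        simp [hA₀'] at this
    obtain ⟨t, ht, hy⟩ := key i j hne hij
    obtain ⟨s, hs, hz⟩ := key j i hne.symm hij.symm
    -- The weights make the opposite displacements of lengths `t` and `s` cancel.
    have := convex_convexHull ℝ F.vertices hy hz (a := s / (s + t)) (b := t / (s + t))
      (by positivity) (by positivity) (by field_simp)
    refine (congrArg (· ∈ F.carrier) ?_).mpr this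
    funext l
    simp only [Pi.add_apply, Pi.smul_apply, Pi.sub_apply, smul_eq_mul]
    field_simp
    ring

/-- The barycenter of the face. -/
noncomputable def bary (F : PermFace n m) : Fin n → ℝ := baryOfKey F.label

theorem slack_bary_eq_zero_iff {F : PermFace n m} {A : Finset (Fin n)} :
    slack A F.bary = 0 ↔ A ∈ F.lows := by
  rw [bary, slack_baryOfKey_eq_zero_iff, mem_lows]

theorem bary_mem_carrier (F : PermFace n m) : F.bary ∈ F.carrier :=
  mem_carrier_iff.2 ⟨baryOfKey_mem _, fun _ hA => slack_bary_eq_zero_iff.2 hA⟩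

theorem slack_bary_pos {F : PermFace n m} {A : Finset (Fin n)} (hA : A ∉ F.lows) :
    0 < slack A F.bary :=
  lt_of_le_of_ne (slack_baryOfKey_nonneg _ _) fun h => hA (slack_bary_eq_zero_iff.1 h.symm)

theorem isClosed_carrier (F : PermFace n m) : IsClosed F.carrier :=
  (((Set.toFinite _).image _ : F.vertices.Finite).isCompact_convexHull ℝ).isClosed

end PermFace

/-! ### Elementary collapses -/

-- The straight-line homotopy from the identity to `r` stays in `X`, so up to homotopy the identity
-- of `X` factors through the contractible `Y`.
open Set in
theorem contractibleSpace_of_segment_subset {E : Type*} [AddCommGroup E] [Module ℝ E]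
    [TopologicalSpace E] [IsTopologicalAddGroup E] [ContinuousSMul ℝ E] {X Y : Set E}
    (hYX : Y ⊆ X) (r : E → E) (hr : ContinuousOn r X) (hm : MapsTo r X Y)
    (hseg : ∀ x ∈ X, segment ℝ x (r x) ⊆ X) (hY : ContractibleSpace Y) : ContractibleSpace X := by
  let i : C(Y, X) := ⟨Set.inclusion hYX, continuous_inclusion hYX⟩
  let q : C(X, Y) := ⟨hm.restrict, hr.mapsToRestrict hm⟩
  have hn : (i.comp q).Nullhomotopic := by
    have := (id_nullhomotopic Y)
    have h2 := (this.comp_right i).comp_left q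
    simpa using h2
  have hcont : Continuous fun z : unitInterval × X =>
      (1 - (z.1 : ℝ)) • (z.2 : E) + (z.1 : ℝ) • r z.2 := by
    have : Continuous fun z : unitInterval × X => r z.2 :=
      (continuousOn_iff_continuous_domRestrict.1 hr).comp continuous_snd
    have h1 : Continuous fun z : unitInterval × X => (z.1 : ℝ) :=
      continuous_subtype_val.comp continuous_fst
    have h2 : Continuous fun z : unitInterval × X => (z.2 : E) :=
      continuous_subtype_val.comp continuous_snd
    exact ((continuous_const.sub h1).smul h2).add (h1.smul this)
  have hh : (ContinuousMap.id X).Homotopic (i.comp q) := ⟨{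
    toFun := fun z => ⟨(1 - (z.1 : ℝ)) • (z.2 : E) + (z.1 : ℝ) • r z.2,
      hseg z.2 z.2.2 ⟨1 - z.1, z.1, by linarith [z.1.2.2], z.1.2.1, by ring, rfl⟩⟩
    continuous_toFun := hcont.subtype_mk _
    map_zero_left := fun x => by ext; simp
    map_one_left := fun x => by
      apply Subtype.ext
      simp [i, q] }⟩
  rw [contractible_iff_id_nullhomotopic]
  obtain ⟨y, hy⟩ := hn
  exact ⟨y, hh.trans hy⟩

namespace PermFace

variable {n m k : ℕ}

/-- A point beyond the facet `F` of the face `U`: only the inequality of `F` is violated. -/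
theorem Refines.exists_beyond {F : PermFace n m} {U : PermFace n k} (hr : F.Refines U) :
    ∃ p : Fin n → ℝ, (∀ A ∈ U.lows, slack A p = 0) ∧
      (∀ A ∈ F.lows, A ∉ U.lows → slack A p < 0) ∧ ∀ A, A ∉ F.lows → 0 < slack A p := by
  -- The point is taken on the ray from the barycenter of `U` through that of `F`, slightly past
  -- `F`, so that inequalities strict on `F` remain strict.
  have hs : ∀ (δ : ℝ) A, slack A (F.bary + δ • (F.bary - U.bary)) =
      slack A F.bary + δ * (slack A F.bary - slack A U.bary) := by
    intro δ A
    rw [slack_add_smul, sum_sub_eq_slack_sub]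
  have hev : ∀ᶠ δ : ℝ in nhdsWithin 0 (Set.Ioi 0), ∀ A, A ∉ F.lows →
      0 < slack A F.bary + δ * (slack A F.bary - slack A U.bary) := by
    refine Filter.Eventually.filter_mono nhdsWithin_le_nhds ?_
    rw [Filter.eventually_all]
    intro A
    by_cases hA : A ∈ F.lows
    · simp [hA]
    · have hc : Continuous fun δ : ℝ =>
          slack A F.bary + δ * (slack A F.bary - slack A U.bary) := by fun_prop
      have h0 := (hc.tendsto 0).eventually_const_lt (u := 0) (by simpa using slack_bary_pos hA)
      filter_upwards [h0] with δ hδ _ using hδ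
  obtain ⟨δ, hδ, hpos⟩ := (hev.and (eventually_mem_nhdsWithin (a := (0 : ℝ)))).exists
  refine ⟨F.bary + δ • (F.bary - U.bary), fun A hA => ?_, fun A hA hAU => ?_, fun A hA => ?_⟩
  · rw [hs, slack_bary_eq_zero_iff.2 hA, slack_bary_eq_zero_iff.2 (refines_iff.1 hr hA)]
    ring
  · rw [hs, slack_bary_eq_zero_iff.2 hA]
    have := mul_pos (Set.mem_Ioi.1 hpos) (slack_bary_pos hAU)
    linarith
  · rw [hs]
    exact hδ A hA

open Classical in
/-- A face `U` retracts to the union of its facets other than `F`. -/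
theorem Refines.exists_retraction {F : PermFace n m} {U : PermFace n (m + 1)} (hr : F.Refines U) :
    ∃ r : (Fin n → ℝ) → (Fin n → ℝ), ContinuousOn r U.carrier ∧
      (∀ x ∈ U.carrier, r x ∈ U.carrier ∧ ∃ A, A ∉ F.lows ∧ slack A (r x) = 0) ∧
      ∀ x ∈ U.carrier, ∀ A, A ∉ F.lows → slack A x = 0 → r x = x := by
  obtain ⟨p, hp0, hpF, hpos⟩ := hr.exists_beyond
  obtain ⟨A₀, hA₀, hFU⟩ := hr.exists_lows_eq_insert
  have hA₀F : A₀ ∈ F.lows := by rw [hFU]; simp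
  have hpA₀ : slack A₀ p < 0 := hpF A₀ hA₀F hA₀
  set W : Finset (Finset (Fin n)) := Finset.univ.filter fun A => A ∉ F.lows with hW
  have hmemW : ∀ A, A ∈ W ↔ A ∉ F.lows := by simp [hW]
  have hlt : ∀ x ∈ U.carrier, ∃ A ∈ W, slack A x < slack A p := by
    intro x hx
    rw [mem_carrier_iff] at hx
    by_contra! hcon
    -- The slack of a singleton is a coordinate minus 1, so `x` dominates `p` coordinatewise. Equal
    -- sums then give `p = x`, although `p` violates the inequality of `A₀`.
    have hle : ∀ i ∈ Finset.univ, p i ≤ x i := by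
      intro i _
      have hsing : ∀ y : Fin n → ℝ, slack {i} y = y i - 1 := by intro y; simp [slack]
      have : slack {i} p ≤ slack {i} x := by
        by_cases h : ({i} : Finset (Fin n)) ∈ F.lows
        · by_cases h' : ({i} : Finset (Fin n)) ∈ U.lows
          · rw [hp0 _ h', hx.2 _ h']
          · exact (hpF _ h h').le.trans (hx.1.1 _)
        · exact hcon _ ((hmemW _).2 h)
      rw [hsing, hsing] at this
      linarith
    have hsum : ∑ i, p i = ∑ i, x i := by
      have h1 := hp0 _ U.univ_mem_lows
      have h2 := hx.1.2
      unfold slack at h1 h2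
      linarith
    have heq := (Finset.sum_eq_sum_iff_of_le hle).1 hsum
    have : p = x := funext fun i => heq i (Finset.mem_univ i)
    rw [this] at hpA₀
    exact absurd (hx.1.1 A₀) (not_le.2 hpA₀)
  have hWne : W.Nonempty := by
    obtain ⟨A, hA, -⟩ := hlt _ U.bary_mem_carrier
    exact ⟨A, hA⟩
  -- The retraction is the radial projection from `p`. On the ray `p + s • (x - p)` the slack of `A`
  -- vanishes at `1 / s = 1 - slack A x / slack A p`; the largest such value gives the first
  -- inequality of `W` to become tight, hence the exit point from `U`.
  set τ : (Fin n → ℝ) → ℝ := fun x => W.sup' hWne fun A => 1 - slack A x / slack A p with hτ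
  have hτc : Continuous τ := by
    refine Continuous.finset_sup'_apply hWne fun A _ => ?_
    have := continuous_slack A
    fun_prop
  have hτle : ∀ x, ∀ A ∈ W, slack A p - slack A x ≤ τ x * slack A p := by
    intro x A hA
    have h1 : 1 - slack A x / slack A p ≤ τ x :=
      Finset.le_sup' (fun A => 1 - slack A x / slack A p) hA
    have h2 := hpos A ((hmemW A).1 hA)
    have h3 := mul_le_mul_of_nonneg_right h1 h2.le
    rwa [sub_mul, one_mul, div_mul_cancel₀ _ h2.ne'] at h3
  have hτeq : ∀ x, ∃ A ∈ W, slack A p - slack A x = τ x * slack A p := by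
    intro x
    obtain ⟨A, hA, h1⟩ := W.exists_mem_eq_sup' hWne fun A => 1 - slack A x / slack A p
    have h2 := hpos A ((hmemW A).1 hA)
    refine ⟨A, hA, ?_⟩
    rw [hτ]
    simp only [h1]
    rw [sub_mul, one_mul, div_mul_cancel₀ _ h2.ne']
  have hτpos : ∀ x ∈ U.carrier, 0 < τ x := by
    intro x hx
    obtain ⟨A, hA, h⟩ := hlt x hx
    have h1 := hτle x A hA
    exact pos_of_mul_pos_left (by linarith) (hpos A ((hmemW A).1 hA)).le
  have hτ1 : ∀ x ∈ U.carrier, τ x ≤ 1 := by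
    intro x hx
    obtain ⟨A, hA, h⟩ := hτeq x
    have h0 := (mem_carrier_iff.1 hx).1.1 A
    have h1 := hpos A ((hmemW A).1 hA)
    by_contra! h2
    nlinarith
  have hsl : ∀ x A, slack A (p + (τ x)⁻¹ • (x - p)) =
      slack A p + (τ x)⁻¹ * (slack A x - slack A p) := by
    intro x A
    rw [slack_add_smul, sum_sub_eq_slack_sub]
  refine ⟨fun x => p + (τ x)⁻¹ • (x - p), ?_, fun x hx => ⟨?_, ?_⟩, fun x hx A hA h0 => ?_⟩
  · have h1 : ContinuousOn (fun x : Fin n → ℝ => x - p) U.carrier := by fun_prop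
    refine continuousOn_const.add (ContinuousOn.smul (f := fun x => (τ x)⁻¹) ?_ h1)
    exact hτc.continuousOn.inv₀ fun x hx => (hτpos x hx).ne'
  · have hx' := mem_carrier_iff.1 hx
    have hU : ∀ A ∈ U.lows, slack A (p + (τ x)⁻¹ • (x - p)) = 0 := by
      intro A hA
      rw [hsl, hp0 A hA, hx'.2 A hA]
      ring
    refine mem_carrier_iff.2 ⟨⟨fun A => ?_, hU _ U.univ_mem_lows⟩, hU⟩
    have hτp := hτpos x hx
    by_cases hA : A ∈ F.lows
    · by_cases hAU : A ∈ U.lows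
      · rw [hU A hAU]
      · rw [hsl]
        have h1 := hpF A hA hAU
        have h2 := hx'.1.1 A
        have h3 : 1 ≤ (τ x)⁻¹ := (one_le_inv₀ hτp).2 (hτ1 x hx)
        nlinarith
    · have h1 := hτle x A ((hmemW A).2 hA)
      have h2 : slack A p + (τ x)⁻¹ * (slack A x - slack A p) =
          (τ x)⁻¹ * (τ x * slack A p + (slack A x - slack A p)) := by
        field_simp
      rw [hsl, h2]
      exact mul_nonneg (inv_nonneg.2 hτp.le) (by linarith)
  · obtain ⟨A, hA, h1⟩ := hτeq x
    refine ⟨A, (hmemW A).1 hA, ?_⟩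
    have hτp := hτpos x hx
    rw [hsl, ← neg_sub (slack A p), h1]
    field_simp
    ring
  · have h1 := hτle x A ((hmemW A).2 hA)
    have h2 := hpos A hA
    have h3 : 1 ≤ τ x := by
      rw [h0] at h1
      by_contra! h4
      nlinarith
    have h4 : τ x = 1 := le_antisymm (hτ1 x hx) h3
    simp [h4]

/-- The union of a set of faces. -/
def realization (K : Set (Σ m, PermFace n m)) : Set (Fin n → ℝ) := ⋃ c ∈ K, c.2.carrier

theorem mem_realization {K : Set (Σ m, PermFace n m)} {x : Fin n → ℝ} :
    x ∈ realization K ↔ ∃ c ∈ K, x ∈ c.2.carrier := by simp [realization]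

theorem isClosed_realization (K : Set (Σ m, PermFace n m)) (hK : K.Finite) :
    IsClosed (realization K) :=
  hK.isClosed_biUnion fun c _ => c.2.isClosed_carrier

open Classical in
/-- An elementary collapse preserves contractibility. -/
theorem Refines.contractibleSpace_of_collapse {F : PermFace n m} {U : PermFace n (m + 1)}
    (hr : F.Refines U) {K : Set (Σ m, PermFace n m)} (hfin : K.Finite)
    (hdown : ∀ c ∈ K, ∀ (k : ℕ) (G : PermFace n k), G.Refines c.2 → ⟨k, G⟩ ∈ K)
    (hU : ⟨m + 1, U⟩ ∈ K)
    (hfree : ∀ c ∈ K, F.Refines c.2 → c = ⟨m, F⟩ ∨ c = ⟨m + 1, U⟩)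
    (h : ContractibleSpace (realization (K \ {⟨m, F⟩, ⟨m + 1, U⟩}))) :
    ContractibleSpace (realization K) := by
  set K' : Set (Σ m, PermFace n m) := K \ {⟨m, F⟩, ⟨m + 1, U⟩} with hK'
  obtain ⟨r, hrc, hrm, hrid⟩ := hr.exists_retraction
  have hsub : realization K' ⊆ realization K := Set.biUnion_subset_biUnion_left Set.sdiff_subset
  have hUK : U.carrier ⊆ realization K := fun x hx => mem_realization.2 ⟨_, hU, hx⟩
  have hcover : realization K ⊆ realization K' ∪ U.carrier := by
    intro x hx
    obtain ⟨c, hc, hxc⟩ := mem_realization.1 hx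
    by_cases h1 : c = ⟨m, F⟩
    · subst h1
      exact Or.inr (hr.carrier_subset hxc)
    by_cases h2 : c = ⟨m + 1, U⟩
    · subst h2
      exact Or.inr hxc
    · exact Or.inl (mem_realization.2 ⟨c, ⟨hc, by simp [h1, h2]⟩, hxc⟩)
  have hfix : ∀ x ∈ U.carrier, x ∈ realization K' → r x = x := by
    intro x hxU hx
    obtain ⟨c, hc, hxc⟩ := mem_realization.1 hx
    by_contra hne
    -- A moved point is tight only on the chain of `F`, so a face containing it contains `F`; by
    -- freeness that face is `F` or `U`, which are not in `K'`.
    have htight : ∀ A, slack A x = 0 → A ∈ F.lows := by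
      intro A hA
      by_contra hAF
      exact hne (hrid x hxU A hAF hA)
    have hFc : F.Refines c.2 :=
      refines_iff.2 fun A hA => htight A ((mem_carrier_iff.1 hxc).2 A hA)
    exact hc.2 (hfree c hc.1 hFc)
  have hmaps : ∀ x ∈ U.carrier, r x ∈ realization K' := by
    intro x hx
    obtain ⟨h1, A, hA, h2⟩ := hrm x hx
    -- The smallest face `G` containing `r x` lies in `U`; its tight set outside the chain of `F`
    -- rules out both `F` and `U`.
    obtain ⟨l, G, hG⟩ := exists_face_tight (mem_carrier_iff.1 h1).1
    have hGU : G.Refines U :=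
      refines_iff.2 fun B hB => (hG B).2 ((mem_carrier_iff.1 h1).2 B hB)
    have hAG : A ∈ G.lows := (hG A).2 h2
    refine mem_realization.2 ⟨⟨l, G⟩, ⟨hdown _ hU l G hGU, ?_⟩,
      mem_carrier_iff.2 ⟨(mem_carrier_iff.1 h1).1, fun B hB => (hG B).1 hB⟩⟩
    rintro (e | e)
    · cases e
      exact hA hAG
    · cases e
      exact hA (refines_iff.1 hr hAG)
  have hcl' : IsClosed (realization K') := isClosed_realization K' (hfin.subset Set.sdiff_subset)
  refine contractibleSpace_of_segment_subset hsub
    (fun x => if x ∈ U.carrier then r x else x) ?_ ?_ ?_ h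
  · refine ContinuousOn.mono ?_ hcover
    refine ContinuousOn.union_of_isClosed ?_ ?_ hcl' U.isClosed_carrier
    · refine continuousOn_id.congr fun x hx => ?_
      by_cases hxU : x ∈ U.carrier
      · simp [hxU, hfix x hxU hx]
      · simp [hxU]
    · exact hrc.congr fun x hx => by simp [hx]
  · intro x hx
    by_cases hxU : x ∈ U.carrier
    · simpa [hxU] using hmaps x hxU
    · simpa [hxU] using (hcover hx).resolve_right hxU
  · intro x hx
    by_cases hxU : x ∈ U.carrier
    · simp only [hxU, if_true]
      exact ((convex_convexHull ℝ _).segment_subset hxU (hrm x hxU).1).trans hUK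
    · simpa [hxU] using hx

end PermFace

/-! ### Collapsing subcomplexes to a vertex -/

namespace PermFace

variable {n m k : ℕ} {ρ : Equiv.Perm (Fin n)}

theorem sigma_eq_of_lows_eq {c d : Σ m, PermFace n m} (h : c.2.lows = d.2.lows) : c = d := by
  obtain ⟨m, F⟩ := c
  obtain ⟨k, G⟩ := d
  have h1 := F.card_lows
  have h2 := G.card_lows
  simp only at h
  rw [h] at h1
  obtain rfl : m = k := by omega
  rw [eq_of_lows_eq h]

instance : Finite (Σ m, PermFace n m) :=
  Finite.of_injective (fun c : Σ m, PermFace n m => c.2.lows) fun _ _ => sigma_eq_of_lows_eq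

theorem Refines.sigma_eq {F : PermFace n m} {G : PermFace n k} (h : F.Refines G) (hk : k ≤ m) :
    (⟨k, G⟩ : Σ m, PermFace n m) = ⟨m, F⟩ := by
  have h1 := F.card_lows
  have h2 := G.card_lows
  exact sigma_eq_of_lows_eq (Finset.eq_of_subset_of_card_le (refines_iff.1 h)
    (by change F.lows.card ≤ G.lows.card; omega))

theorem Refines.trans {l : ℕ} {F : PermFace n m} {G : PermFace n k} {H : PermFace n l}
    (h : F.Refines G) (h' : G.Refines H) : F.Refines H := fun i j hij => h' i j (h i j hij)

theorem not_isLower_vertexFace : ¬ IsLower ρ (vertexFace ρ) :=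
  fun ⟨a, ha, _⟩ => not_isPivot_vertexFace a ha

/-- A nonempty subcomplex that is closed under the matching has a free face that is matched with the
unique face containing it. -/
theorem exists_free_face {K : Set (Σ m, PermFace n m)}
    (hdown : ∀ c ∈ K, ∀ (k : ℕ) (G : PermFace n k), G.Refines c.2 → ⟨k, G⟩ ∈ K)
    (hne : ∃ c ∈ K, IsLower ρ c.2) :
    ∃ (m : ℕ) (F : PermFace n m) (U : PermFace n (m + 1)), ⟨m, F⟩ ∈ K ∧ Matched ρ F U ∧
      ∀ c ∈ K, F.Refines c.2 → c = ⟨m, F⟩ ∨ c = ⟨m + 1, U⟩ := by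
  -- The free face is a lower face of maximal dimension and, among these, with the fewest ascents. A
  -- larger face containing it cannot be lower, hence is upper; if its partner were another face,
  -- acyclicity would give that partner fewer ascents.
  obtain ⟨c₀, ⟨hc₀, hl₀⟩, hmax⟩ := Set.exists_max_image {c | c ∈ K ∧ IsLower ρ c.2} Sigma.fst
    (Set.toFinite _) hne
  obtain ⟨m, F₀⟩ := c₀
  obtain ⟨F, ⟨hF, hl⟩, hmin⟩ := Set.exists_min_image
    {F : PermFace n m | ⟨m, F⟩ ∈ K ∧ IsLower ρ F} (ascents ρ) (Set.toFinite _) ⟨F₀, hc₀, hl₀⟩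
  obtain ⟨U, hU⟩ := hl.exists_matched
  refine ⟨m, F, U, hF, hU, ?_⟩
  rintro ⟨k, G⟩ hG hFG
  rcases le_or_gt k m with hk | hk
  · exact Or.inl (hFG.sigma_eq hk)
  right
  have hGl : ¬ IsLower ρ G := fun h => absurd (hmax ⟨k, G⟩ ⟨hG, h⟩) (not_le.2 hk)
  have hGu : IsUpper ρ G := by
    by_contra hGu
    have h1 := lows_eq_vertexFace hGl hGu
    have h2 := G.card_lows
    have h3 := (vertexFace ρ).card_lows
    rw [h1] at h2
    omega
  obtain ⟨l, rfl⟩ : ∃ l, k = l + 1 := ⟨k - 1, by omega⟩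
  obtain ⟨F', hF'⟩ := hGu.exists_matched
  have hF'K := hdown _ hG _ F' hF'.refines
  have hlm : l ≤ m := hmax ⟨l, F'⟩ ⟨hF'K, hF'.isLower⟩
  obtain rfl : l = m := by omega
  by_cases hFF' : F = F'
  · subst hFF'
    rw [hU.right_unique hF']
  · exact absurd (hmin F' ⟨hF'K, hF'.isLower⟩) (not_le.2 (hF'.ascents_lt hl hFG hFF'))

/-- A subcomplex that is closed under the matching is contractible. -/
theorem contractibleSpace_realization (K : Set (Σ m, PermFace n m))
    (hdown : ∀ c ∈ K, ∀ (k : ℕ) (G : PermFace n k), G.Refines c.2 → ⟨k, G⟩ ∈ K)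
    (hmatch : ∀ (m : ℕ) (F : PermFace n m) (U : PermFace n (m + 1)), Matched ρ F U →
      ⟨m, F⟩ ∈ K → ⟨m + 1, U⟩ ∈ K)
    (hv : ⟨0, vertexFace ρ⟩ ∈ K) : ContractibleSpace (realization K) := by
  induction hk : K.ncard using Nat.strong_induction_on generalizing K with
  | _ k ih =>
  by_cases hne : ∃ c ∈ K, IsLower ρ c.2
  · obtain ⟨m, F, U, hF, hFU, hfree⟩ := exists_free_face hdown hne
    have hU := hmatch m F U hFU hF
    refine hFU.refines.contractibleSpace_of_collapse (Set.toFinite K) hdown hU hfree ?_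
    refine ih _ ?_ _ ?_ ?_ ?_ rfl
    · rw [← hk]
      refine Set.ncard_lt_ncard ?_
      exact ⟨Set.sdiff_subset, fun h => (h hF).2 (by simp)⟩
    · intro c hc l G hG
      refine ⟨hdown c hc.1 l G hG, ?_⟩
      rintro (e | e)
      · cases e
        exact hc.2 (hfree c hc.1 hG)
      · cases e
        exact hc.2 (hfree c hc.1 (hFU.refines.trans hG))
    · intro l F₁ U₁ h₁ hF₁
      refine ⟨hmatch l F₁ U₁ h₁ hF₁.1, ?_⟩
      rintro (e | e)
      · cases e
        exact hFU.isLower.not_isUpper h₁.isUpper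
      · cases e
        exact hF₁.2 (by simp [h₁.left_unique hFU])
    · refine ⟨hv, ?_⟩
      rintro (e | e)
      · have h1 := hFU.isLower
        cases e
        exact not_isLower_vertexFace h1
      · cases e
  -- Without lower faces there are no upper ones either, since `K` would contain their partners.
  · have hK : K = {⟨0, vertexFace ρ⟩} := by
      refine Set.eq_singleton_iff_unique_mem.2 ⟨hv, ?_⟩
      rintro ⟨l, G⟩ hG
      refine sigma_eq_of_lows_eq (lows_eq_vertexFace (fun h => hne ⟨_, hG, h⟩) fun h => ?_)
      rcases l with _ | l
      · exact not_isUpper_zero G h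
      · obtain ⟨F, hF⟩ := h.exists_matched
        exact hne ⟨_, hdown _ hG _ F hF.refines, hF.isLower⟩
    rw [hK, realization, Set.biUnion_singleton]
    exact Convex.contractibleSpace (convex_convexHull ℝ _) ⟨_, bary_mem_carrier _⟩

theorem Refines.depth_le {F : PermFace n m} {G : PermFace n k} (h : F.Refines G)
    (Z : Finset (Fin n × Fin n)) : G.depth Z ≤ F.depth Z :=
  Finset.card_le_card (Finset.monotone_filter_right _ fun _ _ hz => h.label_lt hz)

theorem SameAscents.depth_eq {F : PermFace n m} {G : PermFace n k} (h : SameAscents 1 F G)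
    {Z : Finset (Fin n × Fin n)} (hZ : ∀ z ∈ Z, z.1 < z.2) : F.depth Z = G.depth Z := by
  unfold depth
  congr 1
  exact Finset.filter_congr fun z hz => h _ _ (hZ z hz)

end PermFace

/-- For `ρ = 1` every pair in `Z` is increasing, so the matching preserves depth. The vertex of the
identity has the maximal depth `Z.card`, hence lies in every nonempty depth subcomplex. -/
theorem depthSubcomplex_empty_or_contractibleSpace {n : ℕ} (Z : Finset (Fin n × Fin n))
    (hZ : ∀ z ∈ Z, z.1 < z.2) (r : ℕ) :
    depthSubcomplex Z r = ∅ ∨ ContractibleSpace (depthSubcomplex Z r) := by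
  rw [or_iff_not_imp_left]
  intro hne
  have heq : depthSubcomplex Z r =
      PermFace.realization {c : Σ m, PermFace n m | r ≤ c.2.depth Z} := by
    ext x
    simp [depthSubcomplex, PermFace.realization, Sigma.exists]
  have hr : r ≤ Z.card := by
    obtain ⟨x, hx⟩ := Set.nonempty_iff_ne_empty.2 hne
    rw [heq, PermFace.mem_realization] at hx
    obtain ⟨c, hc, -⟩ := hx
    exact le_trans hc (Finset.card_filter_le _ _)
  rw [heq]
  refine PermFace.contractibleSpace_realization (ρ := 1) _ ?_ ?_ ?_
  · intro c hc k G hG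
    exact le_trans hc (hG.depth_le Z)
  · intro m F U h hF
    exact le_of_le_of_eq hF (h.sameAscents.depth_eq hZ)
  · refine hr.trans (le_of_eq ?_)
    rw [PermFace.depth, Finset.filter_true_of_mem]
    exact fun z hz => hZ z hz

/-! ### Volume forms and incidence signs -/

namespace AlternatingMap

variable {V U : Type*} [AddCommGroup V] [Module ℝ V] [AddCommGroup U] [Module ℝ U] {m : ℕ}

theorem exists_eq_smul_of_finrank_eq [Module.Finite ℝ U] (hU : Module.finrank ℝ U = m)
    (η : U [⋀^Fin m]→ₗ[ℝ] ℝ) {ω : U [⋀^Fin m]→ₗ[ℝ] ℝ} (hω : ω ≠ 0) : ∃ c : ℝ, η = c • ω := by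
  let b := Module.finBasisOfFinrankEq ℝ U hU
  refine ⟨η b / ω b, ?_⟩
  have hb := (map_basis_ne_zero_iff b ω).2 hω
  have h1 := eq_smul_basis_det b η
  have h2 := eq_smul_basis_det b ω
  calc η = (η b / ω b) • (ω b • b.det) := by rw [smul_smul, div_mul_cancel₀ _ hb, ← h1]
    _ = _ := by rw [← h2]

/-- Contraction with a vector, followed by restriction along a linear map. -/
def contract (ω : V [⋀^Fin (m + 1)]→ₗ[ℝ] ℝ) (j : U →ₗ[ℝ] V) :
    V →ₗ[ℝ] U [⋀^Fin m]→ₗ[ℝ] ℝ where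
  toFun w := (ω.curryLeft w).compLinearMap j
  map_add' x y := by ext; simp
  map_smul' c x := by ext; simp

theorem contract_apply (ω : V [⋀^Fin (m + 1)]→ₗ[ℝ] ℝ) (j : U →ₗ[ℝ] V) (w : V) (u : Fin m → U) :
    contract ω j w u = ω (Matrix.vecCons w (j ∘ u)) := rfl

/-- All `m + 1` arguments come from the `m`-dimensional space `U`, so they are dependent. -/
theorem contract_map [Module.Finite ℝ U] (hU : Module.finrank ℝ U = m)
    (ω : V [⋀^Fin (m + 1)]→ₗ[ℝ] ℝ) (j : U →ₗ[ℝ] V) (u₀ : U) : contract ω j (j u₀) = 0 := by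
  ext u
  have h : Matrix.vecCons (j u₀) (j ∘ u) = j ∘ Matrix.vecCons u₀ u := by
    funext i
    refine Fin.cases ?_ (fun i => ?_) i <;> rfl
  rw [contract_apply, h]
  refine (ω.compLinearMap j).map_linearDependent _ fun hli => ?_
  have := hli.fintype_card_le_finrank
  rw [hU] at this
  simp at this

/-- The functional `l` separates `w` from the image of `U`, so `w` followed by a basis of `U` is a
basis of `V`. -/
theorem contract_ne_zero [Module.Finite ℝ U] [Module.Finite ℝ V] (hU : Module.finrank ℝ U = m)
    (hV : Module.finrank ℝ V = m + 1) {ω : V [⋀^Fin (m + 1)]→ₗ[ℝ] ℝ} (hω : ω ≠ 0)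
    {j : U →ₗ[ℝ] V} (hj : Function.Injective j) (l : V →ₗ[ℝ] ℝ) (hl : ∀ u, l (j u) = 0) {w : V}
    (hw : l w ≠ 0) : contract ω j w ≠ 0 := by
  intro h
  let b := Module.finBasisOfFinrankEq ℝ U hU
  have hli : LinearIndependent ℝ (Matrix.vecCons w (j ∘ b)) := by
    refine linearIndependent_finCons.2
      ⟨b.linearIndependent.map' j (LinearMap.ker_eq_bot.2 hj), fun hspan => hw ?_⟩
    have hle : Submodule.span ℝ (Set.range (j ∘ b)) ≤ LinearMap.ker l := by
      rw [Submodule.span_le]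
      rintro _ ⟨i, rfl⟩
      exact hl _
    exact hle hspan
  let e := basisOfLinearIndependentOfCardEqFinrank hli (by simp [hV])
  refine (map_basis_ne_zero_iff e ω).2 hω ?_
  rw [coe_basisOfLinearIndependentOfCardEqFinrank, ← contract_apply, h, zero_apply]

/-- Modulo the hyperplane `ker l`, which comes from `U`, the vector `w'` is a multiple of `w`. Hence
the contraction with an outward vector depends, up to a positive factor, only on the side of the
hyperplane. -/
theorem contract_eq_smul [Module.Finite ℝ U] (hU : Module.finrank ℝ U = m)
    (ω : V [⋀^Fin (m + 1)]→ₗ[ℝ] ℝ) (j : U →ₗ[ℝ] V) (l : V →ₗ[ℝ] ℝ)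
    (hl : ∀ v, l v = 0 → ∃ u, j u = v) {w : V} (hw : l w ≠ 0) (w' : V) :
    contract ω j w' = (l w' / l w) • contract ω j w := by
  obtain ⟨u, hu⟩ := hl (w' - (l w' / l w) • w) (by
    rw [map_sub, map_smul, smul_eq_mul, div_mul_cancel₀ _ hw, sub_self])
  have h := contract_map hU ω j u
  rw [hu, map_sub, map_smul, sub_eq_zero] at h
  exact h

theorem map_vecCons_swap (ω : V [⋀^Fin (m + 1 + 1)]→ₗ[ℝ] ℝ) (v w : V) (u : Fin m → V) :
    ω (Matrix.vecCons v (Matrix.vecCons w u)) = -ω (Matrix.vecCons w (Matrix.vecCons v u)) := by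
  rw [← ω.map_swap _ (show (0 : Fin (m + 1 + 1)) ≠ 1 by simp)]
  congr 1
  funext i
  refine Fin.cases ?_ (fun i => ?_) i
  · simp
  · refine Fin.cases ?_ (fun i => ?_) i
    · simp
    · rw [Function.comp_apply, Equiv.swap_apply_of_ne_of_ne]
      · rfl
      · exact Fin.succ_ne_zero _
      · rw [← Fin.succ_zero_eq_one]
        exact fun h => Fin.succ_ne_zero _ (Fin.succ_injective _ h)

/-- Contractions with two vectors in both orders differ by a sign. -/
theorem contract_contract_coeff {U₁ U₂ : Type*} [AddCommGroup U₁] [Module ℝ U₁] [AddCommGroup U₂]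
    [Module ℝ U₂] {ω : V [⋀^Fin (m + 1 + 1)]→ₗ[ℝ] ℝ} {ω₁ : U₁ [⋀^Fin (m + 1)]→ₗ[ℝ] ℝ}
    {ω₂ : U₂ [⋀^Fin (m + 1)]→ₗ[ℝ] ℝ} {η : U [⋀^Fin m]→ₗ[ℝ] ℝ} (hη : η ≠ 0) {j₁ : U₁ →ₗ[ℝ] V}
    {j₂ : U₂ →ₗ[ℝ] V} {i₁ : U →ₗ[ℝ] U₁} {i₂ : U →ₗ[ℝ] U₂} (hcomm : ∀ u, j₁ (i₁ u) = j₂ (i₂ u))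
    {a : U₁} {b : U₂} {c₁ d₁ c₂ d₂ : ℝ} (h₁ : contract ω j₁ (j₂ b) = c₁ • ω₁)
    (h₁' : contract ω₁ i₁ a = d₁ • η) (h₂ : contract ω j₂ (j₁ a) = c₂ • ω₂)
    (h₂' : contract ω₂ i₂ b = d₂ • η) : c₁ * d₁ = -(c₂ * d₂) := by
  obtain ⟨u, hu⟩ : ∃ u, η u ≠ 0 := by
    by_contra! h
    exact hη (AlternatingMap.ext h)
  have D₁ := DFunLike.congr_fun h₁' u
  have D₂ := DFunLike.congr_fun h₂' u
  have E₁ := DFunLike.congr_fun h₁ (Matrix.vecCons a (i₁ ∘ u))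
  have E₂ := DFunLike.congr_fun h₂ (Matrix.vecCons b (i₂ ∘ u))
  rw [contract_apply, AlternatingMap.smul_apply, smul_eq_mul] at D₁ D₂ E₁ E₂
  have e₁ : j₁ ∘ Matrix.vecCons a (i₁ ∘ u) = Matrix.vecCons (j₁ a) (j₁ ∘ i₁ ∘ u) := by
    funext i
    refine Fin.cases ?_ (fun i => ?_) i <;> rfl
  have e₂ : j₂ ∘ Matrix.vecCons b (i₂ ∘ u) = Matrix.vecCons (j₂ b) (j₁ ∘ i₁ ∘ u) := by
    funext i
    refine Fin.cases ?_ (fun i => ?_) i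
    · rfl
    · exact (hcomm (u i)).symm
  rw [D₁, e₁, map_vecCons_swap] at E₁
  rw [D₂, e₂] at E₂
  refine mul_right_cancel₀ hu ?_
  linear_combination -E₁ - E₂

end AlternatingMap

theorem Submodule.inclusion_inclusion_eq {R M : Type*} [Semiring R] [AddCommMonoid M] [Module R M]
    {p q₁ q₂ r : Submodule R M} (h₁ : p ≤ q₁) (h₁' : q₁ ≤ r) (h₂ : p ≤ q₂) (h₂' : q₂ ≤ r) (x : p) :
    inclusion h₁' (inclusion h₁ x) = inclusion h₂' (inclusion h₂ x) := rfl

namespace PermFace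

variable {n m k : ℕ}

/-- The barycenter satisfies strictly all inequalities outside the chain, so a small displacement
that preserves the tight ones stays in the face. -/
theorem mem_direction_iff {F : PermFace n m} {v : Fin n → ℝ} :
    v ∈ F.direction ↔ ∀ A ∈ F.lows, ∑ i ∈ A, v i = 0 := by
  constructor
  · intro hv A hA
    refine Submodule.span_induction (p := fun v _ => ∑ i ∈ A, v i = 0) ?_ ?_ ?_ ?_ hv
    · rintro _ ⟨x, hx, y, hy, rfl⟩
      have := sum_sub_eq_slack_sub A x y
      simp only [vsub_eq_sub]
      rw [this, (mem_carrier_iff.1 hx).2 A hA, (mem_carrier_iff.1 hy).2 A hA, sub_self]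
    · simp
    · intro x y _ _ hx hy
      simp [Finset.sum_add_distrib, hx, hy]
    · intro c x _ hx
      simp [← Finset.mul_sum, hx]
  · intro hv
    have hev : ∀ᶠ δ : ℝ in nhdsWithin 0 (Set.Ioi 0), ∀ A, A ∉ F.lows →
        0 < slack A F.bary + δ * ∑ i ∈ A, v i := by
      refine Filter.Eventually.filter_mono nhdsWithin_le_nhds ?_
      rw [Filter.eventually_all]
      intro A
      by_cases hA : A ∈ F.lows
      · simp [hA]
      · have hc : Continuous fun δ : ℝ => slack A F.bary + δ * ∑ i ∈ A, v i := by fun_prop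
        have h0 := (hc.tendsto 0).eventually_const_lt (u := 0) (by simpa using slack_bary_pos hA)
        filter_upwards [h0] with δ hδ _ using hδ
    obtain ⟨δ, hδ, hpos⟩ := (hev.and (eventually_mem_nhdsWithin (a := (0 : ℝ)))).exists
    have hzero : ∀ A ∈ F.lows, slack A (F.bary + δ • v) = 0 := by
      intro A hA
      rw [slack_add_smul, hv A hA, slack_bary_eq_zero_iff.2 hA]
      simp
    have hmem : F.bary + δ • v ∈ F.carrier := by
      refine mem_carrier_iff.2 ⟨⟨fun A => ?_, hzero _ F.univ_mem_lows⟩, hzero⟩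
      by_cases hA : A ∈ F.lows
      · exact (hzero A hA).ge
      · rw [slack_add_smul]
        exact (hδ A hA).le
    have h := vsub_mem_vectorSpan ℝ hmem F.bary_mem_carrier
    simp only [vsub_eq_sub, add_sub_cancel_left] at h
    exact (Submodule.smul_mem_iff _ (ne_of_gt hpos)).1 h

/-- The sums of the coordinates over the blocks of `F`. -/
def blockSum (F : PermFace n m) : (Fin n → ℝ) →ₗ[ℝ] (Fin F.numBlocks → ℝ) where
  toFun v t := ∑ i with F.label i = t, v i
  map_add' x y := by funext t; simp [Finset.sum_add_distrib]
  map_smul' c x := by funext t; simp [Finset.mul_sum]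

theorem direction_eq_ker (F : PermFace n m) : F.direction = LinearMap.ker F.blockSum := by
  ext v
  rw [mem_direction_iff, LinearMap.mem_ker]
  constructor
  · intro h
    funext t
    obtain ⟨i, rfl⟩ := F.surj t
    have h1 := h _ (F.filter_le_mem_lows i)
    have h2 := h (Finset.univ.filter fun j => F.label j < F.label i) (by
      rw [mem_lows]
      intro a ha b hb
      simp only [Finset.mem_filter, Finset.mem_univ, true_and] at ha ⊢
      exact hb.trans_lt ha)
    have h3 : (Finset.univ.filter fun j => F.label j ≤ F.label i) =
        (Finset.univ.filter fun j => F.label j < F.label i) ∪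
          Finset.univ.filter fun j => F.label j = F.label i := by
      ext j
      simp [le_iff_lt_or_eq]
    rw [h3, Finset.sum_union, h2, zero_add] at h1
    · exact h1
    · rw [Finset.disjoint_filter]
      exact fun j _ h4 h5 => h4.ne h5
  · intro h A hA
    rw [← Finset.sum_fiberwise_of_maps_to (t := Finset.univ) (g := F.label) (by simp)]
    refine Finset.sum_eq_zero fun t _ => ?_
    have ht : ∑ i with F.label i = t, v i = 0 := congrFun h t
    by_cases hex : ∃ i ∈ A, F.label i = t
    · obtain ⟨i, hi, rfl⟩ := hex
      rw [← ht]
      refine Finset.sum_congr ?_ fun _ _ => rfl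
      ext j
      simp only [Finset.mem_filter, Finset.mem_univ, true_and, and_iff_right_iff_imp]
      exact fun hj => mem_lows.1 hA i hi j hj.le
    · rw [Finset.filter_false_of_mem, Finset.sum_empty]
      exact fun i hi hit => hex ⟨i, hi, hit⟩

/-- The direction is the kernel of the surjection onto the block sums, of dimension `n - p = m`. A
preimage of `w` puts each block sum on one chosen index of the block. -/
theorem finrank_direction (F : PermFace n m) : Module.finrank ℝ F.direction = m := by
  have hsurj : LinearMap.range F.blockSum = ⊤ := by
    rw [LinearMap.range_eq_top]
    intro w
    refine ⟨fun i => if i = Function.surjInv F.surj (F.label i) then w (F.label i) else 0, ?_⟩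
    funext t
    change ∑ i with F.label i = t, _ = _
    rw [Finset.sum_eq_single (Function.surjInv F.surj t)]
    · simp [Function.surjInv_eq]
    · intro i hi hne
      rw [Finset.mem_filter] at hi
      rw [hi.2, if_neg hne]
    · intro h
      simp [Function.surjInv_eq] at h
  have h := LinearMap.finrank_range_add_finrank_ker F.blockSum
  rw [hsurj, finrank_top, Module.finrank_fin_fun, Module.finrank_fin_fun] at h
  rw [direction_eq_ker]
  have := F.dim_eq
  omega

/-- The sum of the coordinates in `A`, as a functional on the direction of a face. -/
def sumOn (F : PermFace n m) (A : Finset (Fin n)) : F.direction →ₗ[ℝ] ℝ :=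
  (∑ i ∈ A, LinearMap.proj i : (Fin n → ℝ) →ₗ[ℝ] ℝ) ∘ₗ F.direction.subtype

theorem sumOn_apply (F : PermFace n m) (A : Finset (Fin n)) (v : F.direction) :
    F.sumOn A v = ∑ i ∈ A, (v : Fin n → ℝ) i := by
  simp [sumOn]

end PermFace

open PermFace AlternatingMap in
/-- The incidence sign is the sign of the coefficient that relates the contraction of a volume form
of `F'` with an outward vector to a volume form of `F`. -/
theorem FaceOrientation.sign_eq {n m : ℕ} (o : FaceOrientation n) {F : PermFace n m}
    {F' : PermFace n (m + 1)} (hr : F.Refines F') {A : Finset (Fin n)} (hA : A ∉ F'.lows)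
    (hF : F.lows = insert A F'.lows) (w : F'.direction)
    (hw : ∑ i ∈ A, (w : Fin n → ℝ) i < 0) :
    ∃ c : ℝ, c ≠ 0 ∧ o.sign F F' = (if 0 < c then 1 else -1) ∧
      contract (o (m + 1) F').someVector (Submodule.inclusion hr.direction_le) w =
        c • (o m F).someVector := by
  have hAF : A ∈ F.lows := by rw [hF]; simp
  have hω := (o (m + 1) F').someVector_ne_zero
  have hη := (o m F).someVector_ne_zero
  set ω := (o (m + 1) F').someVector
  set η := (o m F).someVector
  set j := Submodule.inclusion hr.direction_le
  have hj : Function.Injective j := Submodule.inclusion_injective _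
  have hl : ∀ u, F'.sumOn A (j u) = 0 := fun u => by
    rw [sumOn_apply]
    exact mem_direction_iff.1 u.2 A hAF
  have hl' : ∀ v, F'.sumOn A v = 0 → ∃ u, j u = v := by
    intro v hv
    rw [sumOn_apply] at hv
    refine ⟨⟨v, mem_direction_iff.2 fun B hB => ?_⟩, Subtype.ext rfl⟩
    rw [hF] at hB
    rcases Finset.mem_insert.1 hB with rfl | hB
    · exact hv
    · exact mem_direction_iff.1 v.2 B hB
  have hw' : F'.sumOn A w < 0 := by rwa [sumOn_apply]
  obtain ⟨c, hc⟩ := exists_eq_smul_of_finrank_eq F.finrank_direction (contract ω j w) hη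
  have hc0 : c ≠ 0 := by
    rintro rfl
    rw [zero_smul] at hc
    exact contract_ne_zero F.finrank_direction F'.finrank_direction hω hj _ hl hw'.ne hc
  refine ⟨c, hc0, ?_, hc⟩
  -- Every admissible difference `x - y` has negative coordinate sum over `A`, like `w`, so
  -- compatibility does not depend on the points chosen.
  have hkey : ∀ (x : Fin n → ℝ) (hx : x ∈ F.carrier) (y : Fin n → ℝ) (hy : y ∈ F'.carrier),
      y ∉ F.carrier → (SameRay ℝ ((ω.curryLeft ⟨x - y, vsub_mem_vectorSpan ℝ
        (hr.carrier_subset hx) hy⟩).compLinearMap j) η ↔ 0 < c) := by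
    intro x hx y hy hyF
    change SameRay ℝ (contract ω j _) η ↔ _
    have hypos : 0 < slack A y := by
      rw [mem_carrier_iff] at hy
      refine lt_of_le_of_ne (hy.1.1 A) fun h0 => hyF (mem_carrier_iff.2 ⟨hy.1, fun B hB => ?_⟩)
      rw [hF] at hB
      rcases Finset.mem_insert.1 hB with rfl | hB
      · exact h0.symm
      · exact hy.2 B hB
    have hneg : F'.sumOn A ⟨x - y, vsub_mem_vectorSpan ℝ (hr.carrier_subset hx) hy⟩ < 0 := by
      rw [sumOn_apply]
      change ∑ i ∈ A, (x - y) i < 0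
      rw [sum_sub_eq_slack_sub, (mem_carrier_iff.1 hx).2 A hAF]
      linarith
    have hpos := div_pos_of_neg_of_neg hneg hw'
    rw [contract_eq_smul F.finrank_direction ω j (F'.sumOn A) hl' hw'.ne, hc, smul_smul,
      sameRay_smul_left_iff_of_ne hη (mul_ne_zero hpos.ne' hc0), mul_pos_iff_of_pos_left hpos]
  rw [FaceOrientation.sign, dif_pos hr]
  congr 1
  refine propext ⟨?_, fun hcp => ?_⟩
  · rintro ⟨x, hx, y, hy, hyF, h⟩
    exact (hkey x hx y hy hyF).1 h
  · have hb : F'.bary ∉ F.carrier := fun h =>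
      (slack_bary_pos hA).ne' ((mem_carrier_iff.1 h).2 A hAF)
    exact ⟨_, F.bary_mem_carrier, _, F'.bary_mem_carrier, hb,
      (hkey _ F.bary_mem_carrier _ F'.bary_mem_carrier hb).2 hcp⟩

theorem ite_pos_mul_ite_pos {a b : ℝ} (ha : a ≠ 0) (hb : b ≠ 0) :
    (if 0 < a then (1 : ℂ) else -1) * (if 0 < b then 1 else -1) = if 0 < a * b then 1 else -1 := by
  rcases ha.lt_or_gt with ha | ha <;> rcases hb.lt_or_gt with hb | hb
  · simp [ha.not_gt, hb.not_gt, mul_pos_of_neg_of_neg ha hb]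
  · simp [ha.not_gt, hb, (mul_neg_of_neg_of_pos ha hb).not_gt]
  · simp [ha, hb.not_gt, (mul_neg_of_pos_of_neg ha hb).not_gt]
  · simp [ha, hb, mul_pos ha hb]

theorem ite_pos_neg {a : ℝ} (ha : a ≠ 0) :
    (if 0 < -a then (1 : ℂ) else -1) = -(if 0 < a then 1 else -1) := by
  rcases ha.lt_or_gt with ha | ha
  · simp [ha, ha.not_gt]
  · simp [ha, ha.le]

open PermFace AlternatingMap in
/-- The incidence signs of the two faces between a face and a face of codimension two cancel. -/
theorem FaceOrientation.sign_mul_add_sign_mul {n m : ℕ} (o : FaceOrientation n)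
    {F : PermFace n m} {G₁ G₂ : PermFace n (m + 1)} {H : PermFace n (m + 1 + 1)}
    {A B : Finset (Fin n)} (hAB : A ≠ B) (hA : A ∉ H.lows) (hB : B ∉ H.lows)
    (h₁ : G₁.lows = insert A H.lows) (h₂ : G₂.lows = insert B H.lows)
    (hF : F.lows = insert B (insert A H.lows)) :
    o.sign F G₁ * o.sign G₁ H + o.sign F G₂ * o.sign G₂ H = 0 := by
  have hr₁ : G₁.Refines H := refines_iff.2 (h₁ ▸ Finset.subset_insert _ _)
  have hr₂ : G₂.Refines H := refines_iff.2 (h₂ ▸ Finset.subset_insert _ _)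
  have hF₁ : F.lows = insert B G₁.lows := by rw [hF, h₁]
  have hF₂ : F.lows = insert A G₂.lows := by rw [hF, h₂, Finset.insert_comm]
  have hs₁ : F.Refines G₁ := refines_iff.2 (hF₁ ▸ Finset.subset_insert _ _)
  have hs₂ : F.Refines G₂ := refines_iff.2 (hF₂ ▸ Finset.subset_insert _ _)
  have hB₁ : B ∉ G₁.lows := by
    rw [h₁, Finset.mem_insert]
    exact fun h => h.elim (fun e => hAB e.symm) hB
  have hA₂ : A ∉ G₂.lows := by
    rw [h₂, Finset.mem_insert]
    exact fun h => h.elim hAB hA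
  have hAF : A ∈ F.lows := by rw [hF₂]; simp
  have hBF : B ∈ F.lows := by rw [hF₁]; simp
  -- The same vector is outward for `F` in `G₂` and, viewed in `H`, outward for `G₁`, since both are
  -- tested by the sum over `A`; symmetrically for the other one with `B`. Both routes thus contract
  -- one form on `H` with the same two vectors, in opposite orders.
  have hv₁ : F.bary - G₂.bary ∈ G₂.direction :=
    vsub_mem_vectorSpan ℝ (hs₂.carrier_subset F.bary_mem_carrier) G₂.bary_mem_carrier
  have hv₂ : F.bary - G₁.bary ∈ G₁.direction :=
    vsub_mem_vectorSpan ℝ (hs₁.carrier_subset F.bary_mem_carrier) G₁.bary_mem_carrier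
  have hn₁ : ∑ i ∈ A, (F.bary - G₂.bary) i < 0 := by
    rw [sum_sub_eq_slack_sub, slack_bary_eq_zero_iff.2 hAF]
    have := slack_bary_pos hA₂
    linarith
  have hn₂ : ∑ i ∈ B, (F.bary - G₁.bary) i < 0 := by
    rw [sum_sub_eq_slack_sub, slack_bary_eq_zero_iff.2 hBF]
    have := slack_bary_pos hB₁
    linarith
  obtain ⟨c₁, hc₁, he₁, hω₁⟩ := o.sign_eq hr₁ hA h₁
    (Submodule.inclusion hr₂.direction_le ⟨_, hv₁⟩) hn₁
  obtain ⟨d₁, hd₁, hf₁, hη₁⟩ := o.sign_eq hs₁ hB₁ hF₁ ⟨_, hv₂⟩ hn₂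
  obtain ⟨c₂, hc₂, he₂, hω₂⟩ := o.sign_eq hr₂ hB h₂
    (Submodule.inclusion hr₁.direction_le ⟨_, hv₂⟩) hn₂
  obtain ⟨d₂, hd₂, hf₂, hη₂⟩ := o.sign_eq hs₂ hA₂ hF₂ ⟨_, hv₁⟩ hn₁
  have hprod : c₁ * d₁ = -(c₂ * d₂) :=
    contract_contract_coeff (o m F).someVector_ne_zero (Submodule.inclusion_inclusion_eq _ _ _ _)
      hω₁ hη₁ hω₂ hη₂
  clear hω₁ hη₁ hω₂ hη₂
  have p₁ := ite_pos_mul_ite_pos hd₁ hc₁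
  have p₂ := ite_pos_mul_ite_pos hd₂ hc₂
  rw [he₁, hf₁, he₂, hf₂, p₁, p₂, mul_comm d₁, mul_comm d₂, hprod,
    ite_pos_neg (mul_ne_zero hc₂ hd₂), neg_add_cancel]

/-! ### An ordering of the indices without wheels -/

section Wheels

variable {n : ℕ} {L : Matrix (Fin n) (Fin n) ℂ}

/-- Without wheels, every nonempty set of indices has an element from which no zero entry leads to
another element of the set. -/
theorem exists_sink_of_no_wheel (hL : ¬ ∃ (m : ℕ) (s : Fin m → Fin n), IsWheel L s)
    {T : Finset (Fin n)} (hT : T.Nonempty) : ∃ a ∈ T, ∀ b ∈ T, b ≠ a → L a b ≠ 0 := by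
  by_contra! h
  -- Following zero entries inside the finite set `T`, the orbit of `g` revisits a point. One
  -- minimal period is a wheel, of length at least 2 because `g` fixes no point of `T`.
  choose! g hgT hne hg using h
  obtain ⟨x, hx⟩ := hT
  have hmem : ∀ k, g^[k] x ∈ T := by
    intro k
    induction k with
    | zero => exact hx
    | succ k ih =>
      rw [Function.iterate_succ_apply']
      exact hgT _ ih
  obtain ⟨k, l, hkl, he⟩ : ∃ k l, k < l ∧ g^[k] x = g^[l] x := by
    obtain ⟨k, l, hkl, he⟩ := Finite.exists_ne_map_eq_of_infinite fun k => g^[k] x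
    rcases hkl.lt_or_gt with h | h
    · exact ⟨k, l, h, he⟩
    · exact ⟨l, k, h, he.symm⟩
  set y := g^[k] x with hy
  have hyT : ∀ t, g^[t] y ∈ T := by
    intro t
    rw [hy, ← Function.iterate_add_apply]
    exact hmem _
  have hper : Function.IsPeriodicPt g (l - k) y := by
    change g^[l - k] y = y
    rw [hy, ← Function.iterate_add_apply, Nat.sub_add_cancel hkl.le]
    exact he.symm
  have hpos : 0 < Function.minimalPeriod g y := hper.minimalPeriod_pos (by omega)
  obtain ⟨p, hp⟩ : ∃ p, Function.minimalPeriod g y = p + 1 := ⟨_, (Nat.succ_pred hpos.ne').symm⟩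
  refine hL ⟨p + 1, fun t => g^[(t : ℕ)] y, ?_, ?_, ?_⟩
  · by_contra hlt
    have h1 : Function.minimalPeriod g y = 1 := by omega
    exact hne y (hyT 0) (Function.minimalPeriod_eq_one_iff_isFixedPt.1 h1)
  · intro s t hst
    refine Fin.ext (Function.iterate_injOn_Iio_minimalPeriod ?_ ?_ hst)
    · rw [hp]; exact s.2
    · rw [hp]; exact t.2
  · intro t
    have h1 : ((finRotate (p + 1) t : Fin (p + 1)) : ℕ) = (t + 1) % Function.minimalPeriod g y := by
      rw [hp, finRotate_apply, Fin.val_add, Fin.val_one', Nat.add_mod_mod]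
    change L (g^[t] y) (g^[((finRotate (p + 1) t : Fin (p + 1)) : ℕ)] y) = 0
    rw [h1, Function.iterate_mod_minimalPeriod_eq, Function.iterate_succ_apply']
    exact hg _ (hyT t)

/-- A sink of `T` receives a key larger than all others, and the remaining indices are ordered by
induction. -/
theorem exists_key_of_no_wheel (hL : ¬ ∃ (m : ℕ) (s : Fin m → Fin n), IsWheel L s)
    (T : Finset (Fin n)) :
    ∃ f : Fin n → ℕ, Set.InjOn f T ∧ ∀ i ∈ T, ∀ j ∈ T, f j < f i → L i j ≠ 0 := by
  induction hk : T.card generalizing T with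
  | zero =>
    rw [Finset.card_eq_zero] at hk
    subst hk
    exact ⟨fun _ => 0, by simp, by simp⟩
  | succ k ih =>
    obtain ⟨a, ha, hsink⟩ := exists_sink_of_no_wheel hL (Finset.card_pos.1 (by omega : 0 < T.card))
    obtain ⟨f, hf, hfL⟩ := ih (T.erase a) (by rw [Finset.card_erase_of_mem ha]; omega)
    have hlt : ∀ i ∈ T, i ≠ a → f i < T.sup f + 1 := fun i hi _ =>
      Nat.lt_succ_of_le (Finset.le_sup hi)
    refine ⟨Function.update f a (T.sup f + 1), ?_, ?_⟩
    · intro i hi j hj hij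
      by_cases hia : i = a <;> by_cases hja : j = a
      · rw [hia, hja]
      · rw [hia, Function.update_self, Function.update_of_ne hja] at hij
        exact absurd hij (hlt j hj hja).ne'
      · rw [hja, Function.update_self, Function.update_of_ne hia] at hij
        exact absurd hij (hlt i hi hia).ne
      · rw [Function.update_of_ne hia, Function.update_of_ne hja] at hij
        exact hf (Finset.mem_coe.2 (Finset.mem_erase.2 ⟨hia, hi⟩))
          (Finset.mem_coe.2 (Finset.mem_erase.2 ⟨hja, hj⟩)) hij
    · intro i hi j hj hij
      by_cases hia : i = a
      · subst hia
        refine hsink j hj fun hja => ?_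
        rw [hja] at hij
        exact lt_irrefl _ hij
      · by_cases hja : j = a
        · rw [hja, Function.update_self, Function.update_of_ne hia] at hij
          exact absurd hij (hlt i hi hia).not_gt
        · rw [Function.update_of_ne hia, Function.update_of_ne hja] at hij
          exact hfL i (Finset.mem_erase.2 ⟨hia, hi⟩) j (Finset.mem_erase.2 ⟨hja, hj⟩) hij

/-- Without wheels, the indices can be ordered so that the entries below the diagonal are
nonzero. -/
theorem exists_perm_of_no_wheel (hL : ¬ ∃ (m : ℕ) (s : Fin m → Fin n), IsWheel L s) :
    ∃ ρ : Equiv.Perm (Fin n), ∀ i j, ρ j < ρ i → L i j ≠ 0 := by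
  obtain ⟨f, hf, hfL⟩ := exists_key_of_no_wheel hL Finset.univ
  refine ⟨(Tuple.sort f).symm, fun i j hij => hfL i (Finset.mem_univ _) j (Finset.mem_univ _) ?_⟩
  have h := Tuple.monotone_sort f hij.le
  simp only [Function.comp_apply, Equiv.apply_symm_apply] at h
  refine lt_of_le_of_ne h fun he => ?_
  rw [hf (by simp) (by simp) he] at hij
  exact lt_irrefl _ hij

end Wheels

/-! ### The square of the differential -/

section Differential

open PermFace

variable {n m k l : ℕ} (L : Matrix (Fin n) (Fin n) ℂ)

/-- The product of the entries of `L` over the pairs in a block of `H` that are separated in `F`. -/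
noncomputable def relWeight (F : PermFace n m) (H : PermFace n k) : ℂ :=
  ∏ z : Fin n × Fin n with H.label z.1 = H.label z.2 ∧ F.label z.1 < F.label z.2, L z.1 z.2

/-- A pair that is together in `H` and separated in `F` becomes separated at exactly one of the two
steps. So the product of weights does not depend on the intermediate face. -/
theorem relWeight_mul_relWeight {F : PermFace n m} {G : PermFace n k} {H : PermFace n l}
    (h₁ : F.Refines G) (h₂ : G.Refines H) :
    relWeight L F G * relWeight L G H = relWeight L F H := by
  unfold relWeight
  rw [← Finset.prod_union]
  · congr 1
    ext z
    simp only [Finset.mem_union, Finset.mem_filter, Finset.mem_univ, true_and]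
    constructor
    · rintro (⟨he, hlt⟩ | ⟨he, hlt⟩)
      · exact ⟨le_antisymm (h₂ _ _ he.le) (h₂ _ _ he.ge), hlt⟩
      · exact ⟨he, h₁.label_lt hlt⟩
    · rintro ⟨he, hlt⟩
      rcases (h₁ _ _ hlt.le).lt_or_eq with h | h
      · exact Or.inr ⟨he, h⟩
      · exact Or.inl ⟨h, hlt⟩
  · rw [Finset.disjoint_filter]
    exact fun z _ h h' => h'.2.ne h.1

theorem perturbedDifferential_apply (o : FaceOrientation n) (x : permCochain n m)
    (G : PermFace n (m + 1)) :
    perturbedDifferential L o m x G = ∑ F, faceWeight L F G * o.sign F G * x F := rfl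

theorem FaceOrientation.sign_of_not_refines (o : FaceOrientation n) {F : PermFace n m}
    {G : PermFace n (m + 1)} (h : ¬ F.Refines G) : o.sign F G = 0 := dif_neg h

theorem FaceOrientation.sign_ne_zero (o : FaceOrientation n) {F : PermFace n m}
    {G : PermFace n (m + 1)} (h : F.Refines G) : o.sign F G ≠ 0 := by
  rw [FaceOrientation.sign, dif_pos h]
  split_ifs <;> simp

/-- Exactly two faces lie strictly between a face and a face of codimension two; their weight
products agree and their sign products are opposite. -/
theorem sum_coeff_mul_coeff_eq_zero (o : FaceOrientation n) (F : PermFace n m)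
    (H : PermFace n (m + 1 + 1)) :
    ∑ G : PermFace n (m + 1), faceWeight L G H * o.sign G H * (faceWeight L F G * o.sign F G) =
      0 := by
  have hterm : ∀ G : PermFace n (m + 1), ¬ (F.Refines G ∧ G.Refines H) →
      faceWeight L G H * o.sign G H * (faceWeight L F G * o.sign F G) = 0 := by
    intro G hG
    rw [not_and_or] at hG
    rcases hG with h | h <;> simp [o.sign_of_not_refines h]
  by_cases hFH : F.Refines H
  · have c1 := F.card_lows
    have c2 := H.card_lows
    have hsub := refines_iff.1 hFH
    obtain ⟨A, B, hAB, hsd⟩ := Finset.card_eq_two.1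
      (show (F.lows \ H.lows).card = 2 by rw [Finset.card_sdiff_of_subset hsub]; omega)
    have hA : A ∈ F.lows \ H.lows := by simp [hsd]
    have hB : B ∈ F.lows \ H.lows := by simp [hsd]
    rw [Finset.mem_sdiff] at hA hB
    have hF : F.lows = insert B (insert A H.lows) := by
      rw [← Finset.sdiff_union_of_subset hsub, hsd]
      ext C
      simp only [Finset.mem_union, Finset.mem_insert, Finset.mem_singleton]
      tauto
    have hne : ∀ C, C ∉ H.lows → C ≠ ∅ ∧ C ≠ Finset.univ := by
      intro C hC
      exact ⟨fun e => hC (e ▸ H.empty_mem_lows), fun e => hC (e ▸ H.univ_mem_lows)⟩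
    obtain ⟨G₁, h₁⟩ := exists_erase hB.1 (hne B hB.2).1 (hne B hB.2).2
    obtain ⟨G₂, h₂⟩ := exists_erase hA.1 (hne A hA.2).1 (hne A hA.2).2
    have h₁' : G₁.lows = insert A H.lows := by
      rw [h₁, hF, Finset.erase_insert]
      simp [hAB.symm, hB.2]
    have h₂' : G₂.lows = insert B H.lows := by
      rw [h₂, hF, Finset.insert_comm, Finset.erase_insert]
      simp [hAB, hA.2]
    have hG₁₂ : G₁ ≠ G₂ := by
      rintro rfl
      have : A ∈ insert B H.lows := by rw [← h₂', h₁']; simp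
      simp [hAB, hA.2] at this
    rw [Fintype.sum_eq_add G₁ G₂ hG₁₂]
    · have hs := o.sign_mul_add_sign_mul hAB hA.2 hB.2 h₁' h₂' hF
      have hr₁ : F.Refines G₁ := refines_iff.2 (h₁ ▸ Finset.erase_subset _ _)
      have hr₂ : F.Refines G₂ := refines_iff.2 (h₂ ▸ Finset.erase_subset _ _)
      have hr₁' : G₁.Refines H := refines_iff.2 (h₁' ▸ Finset.subset_insert _ _)
      have hr₂' : G₂.Refines H := refines_iff.2 (h₂' ▸ Finset.subset_insert _ _)
      have w₁ : faceWeight L F G₁ * faceWeight L G₁ H = relWeight L F H :=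
        relWeight_mul_relWeight L hr₁ hr₁'
      have w₂ : faceWeight L F G₂ * faceWeight L G₂ H = relWeight L F H :=
        relWeight_mul_relWeight L hr₂ hr₂'
      linear_combination (o.sign F G₁ * o.sign G₁ H) * w₁ + (o.sign F G₂ * o.sign G₂ H) * w₂ +
        relWeight L F H * hs
    · rintro G ⟨hG₁, hG₂⟩
      refine hterm G ?_
      rintro ⟨hFG, hGH⟩
      obtain ⟨C, hC, hGC⟩ := hGH.exists_lows_eq_insert
      have hCF : C ∈ F.lows \ H.lows :=
        Finset.mem_sdiff.2 ⟨refines_iff.1 hFG (by rw [hGC]; simp), hC⟩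
      rw [hsd, Finset.mem_insert, Finset.mem_singleton] at hCF
      rcases hCF with rfl | rfl
      · exact hG₁ (eq_of_lows_eq (hGC.trans h₁'.symm))
      · exact hG₂ (eq_of_lows_eq (hGC.trans h₂'.symm))
  · refine Finset.sum_eq_zero fun G _ => hterm G ?_
    rintro ⟨h₁, h₂⟩
    exact hFH (h₁.trans h₂)

theorem perturbedDifferential_comp_self (o : FaceOrientation n) (x : permCochain n m) :
    perturbedDifferential L o (m + 1) (perturbedDifferential L o m x) = 0 := by
  have h : (Matrix.of fun (H : PermFace n (m + 1 + 1)) (G : PermFace n (m + 1)) =>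
      faceWeight L G H * o.sign G H) *
      (Matrix.of fun (G : PermFace n (m + 1)) (F : PermFace n m) =>
        faceWeight L F G * o.sign F G) = 0 := by
    ext H F
    exact sum_coeff_mul_coeff_eq_zero L o F H
  rw [perturbedDifferential, perturbedDifferential, Matrix.mulVecLin_apply,
    Matrix.mulVecLin_apply, Matrix.mulVec_mulVec, h, Matrix.zero_mulVec]

end Differential

/-! ### Cohomology from the matching -/

section Exactness

open PermFace

variable {n m : ℕ} {L : Matrix (Fin n) (Fin n) ℂ} {ρ : Equiv.Perm (Fin n)}

/-- Matched faces have the same ascents, so the weight involves only `ρ`-decreasing pairs, where `L`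
does not vanish. -/
theorem faceWeight_ne_zero_of_matched (hρ : ∀ i j, ρ j < ρ i → L i j ≠ 0) {F : PermFace n m}
    {U : PermFace n (m + 1)} (h : Matched ρ F U) : faceWeight L F U ≠ 0 := by
  refine Finset.prod_ne_zero_iff.2 fun z hz => ?_
  simp only [Finset.mem_filter, Finset.mem_univ, true_and] at hz
  refine hρ _ _ ?_
  rcases lt_trichotomy (ρ z.1) (ρ z.2) with hlt | he | hlt
  · exact absurd ((h.sameAscents _ _ hlt).1 hz.2) hz.1.not_lt
  · rw [ρ.injective he] at hz
    exact absurd hz.2 (lt_irrefl _)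
  · exact hlt

/-- Triangularity: if `F` has the most ascents in the support of `y`, any other lower facet of its
partner `U` has more and is outside the support. The `U`-component of the differential is then a
nonzero multiple of `y F`. -/
theorem eq_zero_of_differential_upper_eq_zero (hρ : ∀ i j, ρ j < ρ i → L i j ≠ 0)
    (o : FaceOrientation n) {y : permCochain n m} (hy : ∀ F, ¬ IsLower ρ F → y F = 0)
    (hd : ∀ U, IsUpper ρ U → perturbedDifferential L o m y U = 0) : y = 0 := by
  by_contra hne
  obtain ⟨F₀, hF₀⟩ := Function.ne_iff.1 hne
  obtain ⟨F, hF, hmax⟩ := Set.exists_max_image {F | y F ≠ 0} (ascents ρ) (Set.toFinite _) ⟨F₀, hF₀⟩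
  have hlow : IsLower ρ F := by
    by_contra h
    exact hF (hy F h)
  obtain ⟨U, hU⟩ := hlow.exists_matched
  have h := hd U hU.isUpper
  rw [perturbedDifferential_apply, Fintype.sum_eq_single F] at h
  · exact mul_ne_zero (mul_ne_zero (faceWeight_ne_zero_of_matched hρ hU)
      (o.sign_ne_zero hU.refines)) hF h
  · intro G hG
    by_cases hyG : y G = 0
    · simp [hyG]
    by_cases hGU : G.Refines U
    · have hGl : IsLower ρ G := by
        by_contra h
        exact hyG (hy G h)
      exact absurd (hmax G hyG) (not_le.2 (hU.ascents_lt hGl hGU hG))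
    · simp [o.sign_of_not_refines hGU]

open Classical in
theorem card_isLower_eq_card_isUpper :
    Fintype.card {F : PermFace n m // IsLower ρ F} =
      Fintype.card {U : PermFace n (m + 1) // IsUpper ρ U} := by
  choose u hu using fun F : {F : PermFace n m // IsLower ρ F} => F.2.exists_matched
  refine Fintype.card_of_bijective (f := fun F => ⟨u F, (hu F).isUpper⟩) ⟨?_, ?_⟩
  · intro F G h
    have h' : u F = u G := congrArg Subtype.val h
    have hG := hu G
    rw [← h'] at hG
    exact Subtype.ext ((hu F).left_unique hG)
  · rintro ⟨U, hU⟩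
    obtain ⟨F, hF⟩ := hU.exists_matched
    exact ⟨⟨F, hF.isLower⟩, Subtype.ext ((hu ⟨F, hF.isLower⟩).right_unique hF)⟩

-- The block of the differential from lower to upper faces is injective, and the matching makes it
-- square, hence it is surjective.
open Classical in
theorem exists_differential_upper_eq (hρ : ∀ i j, ρ j < ρ i → L i j ≠ 0)
    (o : FaceOrientation n) (x : permCochain n (m + 1)) :
    ∃ y : permCochain n m, (∀ F, ¬ IsLower ρ F → y F = 0) ∧
      ∀ U, IsUpper ρ U → perturbedDifferential L o m y U = x U := by
  let ext0 : ({F : PermFace n m // IsLower ρ F} → ℂ) →ₗ[ℂ] permCochain n m :=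
    Function.ExtendByZero.linearMap ℂ Subtype.val
  let res : permCochain n (m + 1) →ₗ[ℂ] ({U : PermFace n (m + 1) // IsUpper ρ U} → ℂ) :=
    LinearMap.funLeft ℂ ℂ Subtype.val
  have hext : ∀ y F, ¬ IsLower ρ F → ext0 y F = 0 := by
    intro y F hF
    refine Function.extend_apply' _ _ _ ?_
    rintro ⟨⟨G, hG⟩, rfl⟩
    exact hF hG
  have hinj : Function.Injective (res ∘ₗ perturbedDifferential L o m ∘ₗ ext0) := by
    rw [← LinearMap.ker_eq_bot, LinearMap.ker_eq_bot']
    intro y hy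
    have h0 : ext0 y = 0 := eq_zero_of_differential_upper_eq_zero hρ o (hext y) fun U hU =>
      congrFun hy ⟨U, hU⟩
    funext F
    have := congrFun h0 F.1
    rwa [show ext0 y F.1 = y F from Subtype.val_injective.extend_apply y 0 F] at this
  have hsurj := (LinearMap.injective_iff_surjective_of_finrank_eq_finrank (by
    rw [Module.finrank_fintype_fun_eq_card, Module.finrank_fintype_fun_eq_card,
      card_isLower_eq_card_isUpper])).1 hinj
  obtain ⟨y, hy⟩ := hsurj (res x)
  exact ⟨ext0 y, hext y, fun U hU => congrFun hy ⟨U, hU⟩⟩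

theorem isLower_or_isUpper (F : PermFace n (m + 1)) : IsLower ρ F ∨ IsUpper ρ F := by
  by_contra! h
  have h1 := F.card_lows
  have h2 := (vertexFace ρ).card_lows
  rw [lows_eq_vertexFace h.1 h.2] at h1
  omega

/-- A cocycle of positive degree without upper components vanishes. -/
theorem eq_zero_of_upper_eq_zero (hρ : ∀ i j, ρ j < ρ i → L i j ≠ 0) (o : FaceOrientation n)
    {z : permCochain n (m + 1)} (hz : perturbedDifferential L o (m + 1) z = 0)
    (hu : ∀ U, IsUpper ρ U → z U = 0) : z = 0 :=
  eq_zero_of_differential_upper_eq_zero hρ o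
    (fun F hF => hu F ((isLower_or_isUpper F).resolve_left hF)) fun U _ => by rw [hz]; rfl

/-- A coboundary supplied by the invertible block cancels the upper part of a cocycle; the rest is a
cocycle supported on lower faces, so it vanishes. -/
theorem exact_perturbedDifferential (hρ : ∀ i j, ρ j < ρ i → L i j ≠ 0) (o : FaceOrientation n)
    (m : ℕ) : Function.Exact (perturbedDifferential L o m) (perturbedDifferential L o (m + 1)) := by
  intro x
  constructor
  · intro hx
    obtain ⟨y, -, hy⟩ := exists_differential_upper_eq hρ o x
    refine ⟨y, ?_⟩
    rw [← sub_eq_zero]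
    refine eq_zero_of_upper_eq_zero hρ o ?_ fun U hU => ?_
    · rw [map_sub, hx, perturbedDifferential_comp_self, sub_zero]
    · rw [Pi.sub_apply, hy U hU, sub_self]
  · rintro ⟨y, rfl⟩
    exact perturbedDifferential_comp_self L o y

-- Correcting the basis vector of the unmatched vertex `v` by lower faces gives a cocycle with value
-- 1 at `v`. All other vertices are lower, so a cocycle vanishing at `v` is zero, and the kernel is
-- a line.
open Classical in
theorem finrank_ker_perturbedDifferential (hρ : ∀ i j, ρ j < ρ i → L i j ≠ 0)
    (o : FaceOrientation n) :
    Module.finrank ℂ (LinearMap.ker (perturbedDifferential L o 0)) = 1 := by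
  set v := vertexFace ρ
  obtain ⟨y, hy, hyd⟩ := exists_differential_upper_eq hρ o
    (perturbedDifferential L o 0 (Pi.single v 1))
  have hker : perturbedDifferential L o 0 (Pi.single v 1 - y) = 0 := by
    refine eq_zero_of_upper_eq_zero hρ o (perturbedDifferential_comp_self L o _) fun U hU => ?_
    rw [map_sub, Pi.sub_apply, hyd U hU, sub_self]
  have hv : (Pi.single v 1 - y : permCochain n 0) v = 1 := by
    rw [Pi.sub_apply, hy v not_isLower_vertexFace, Pi.single_eq_same, sub_zero]
  refine finrank_eq_one_iff'.2 ⟨⟨Pi.single v 1 - y, hker⟩, fun h => ?_, fun w => ⟨w.1 v, ?_⟩⟩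
  · have h' : (Pi.single v 1 - y : permCochain n 0) = 0 := congrArg Subtype.val h
    rw [h'] at hv
    exact zero_ne_one hv
  · refine Subtype.ext ?_
    change w.1 v • (Pi.single v 1 - y : permCochain n 0) = w.1
    rw [← sub_eq_zero]
    refine eq_zero_of_differential_upper_eq_zero hρ o (fun F hF => ?_) fun U _ => ?_
    · have : F = v := eq_of_lows_eq (lows_eq_vertexFace hF (not_isUpper_zero F))
      rw [this, Pi.sub_apply, Pi.smul_apply, hv, smul_eq_mul, mul_one, sub_self]
    · rw [map_sub, map_smul, hker, LinearMap.mem_ker.1 w.2, smul_zero, sub_zero]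
      rfl

end Exactness

theorem mainTheorem6 (n : ℕ) :
    (∀ L : Matrix (Fin n) (Fin n) ℂ,
      (¬ ∃ (m : ℕ) (s : Fin m → Fin n), IsWheel L s) →
      ∀ o : FaceOrientation n,
        Module.finrank ℂ (LinearMap.ker (perturbedDifferential L o 0)) = 1 ∧
        ∀ m : ℕ, Function.Exact (perturbedDifferential L o m) (perturbedDifferential L o (m + 1))) ∧
    (∀ Z : Finset (Fin n × Fin n), (∀ z ∈ Z, z.1 < z.2) →
      ∀ r : ℕ, depthSubcomplex Z r = ∅ ∨ ContractibleSpace (depthSubcomplex Z r)) := by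
  refine ⟨fun L hL o => ?_, fun Z hZ r => depthSubcomplex_empty_or_contractibleSpace Z hZ r⟩
  obtain ⟨ρ, hρ⟩ := exists_perm_of_no_wheel hL
  exact ⟨finrank_ker_perturbedDifferential hρ o, exact_perturbedDifferential hρ o⟩
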